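/- Let $\mathbb{D}$ be the open unit disc of $\mathbb{C}$ and $dA=\frac{dx\,dy}{\pi}$ the normalized area measure on $\mathbb{D}$. A radial weight is a nonnegative function $\omega\in L^1([0,1))$, extended to $\mathbb{D}$ by $\omega(z)=\omega(|z|)$, such that $\widehat{\omega}(r)=\int_r^1\omega(s)\,ds>0$ for all $0\le r<1$; write also $\widehat{\omega}(z)=\widehat{\omega}(|z|)$ for $z\in\mathbb{D}$. For nonnegative measurable $\mu$ on $[0,1)$ and $x\ge 0$ let $\mu_x=\int_0^1 s^x\mu(s)\,ds\in[0,\infty]$. A radial weight $\omega$ belongs to $\widehat{\mathcal{D}}$ if there is a constant $C>0$ such that $\widehat{\omega}(r)\le C\,\widehat{\omega}\left(\frac{1+r}{2}\right)$ for all $r<1$ sufficiently close to $1$. For a radial weight $\omega$ let $B^\omega_z(\zeta)=\sum_{n=0}^\infty\frac{(\overline{z}\zeta)^n}{2\omega_{2n+1}}$, $z,\zeta\in\mathbb{D}$, be the reproducing kernel of the weighted Bergman space $A^2_\omega$ of analytic functions $f$ in $\mathbb{D}$ with $\int_{\mathbb{D}}|f|^2\omega\,dA<\infty$, and let $$P_\omega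 f(z)=\int_{\mathbb{D}} f(\zeta)\,\overline{B^\omega_z(\zeta)}\,\omega(\zeta)\,dA(\zeta),\qquad z\in\mathbb{D}.$$ For a radial weight $\nu$ let $L^\infty_{\widehat{\nu}}$ be the space of measurable $f:\mathbb{D}\to\mathbb{C}$ with $\|f\|_{\infty,\widehat{\nu}}=\operatorname{ess\,sup}_{z\in\mathbb{D}}|f(z)|\widehat{\nu}(z)<\infty$, and let $\mathcal{B}^\infty_{\widehat{\nu}}$ be the space of analytic functions $f$ in $\mathbb{D}$ with $\|f\|_{\mathcal{B}^\infty_{\widehat{\nu}}}=\sup_{z\in\mathbb{D}}(1-|z|)\widehat{\nu}(z)|f'(z)|<\infty$. We say that $P_\omega:L^\infty_{\widehat{\nu}}\to\mathcal{B}^\infty_{\widehat{\nu}}$ is bounded if for every $f\in L^\infty_{\widehat{\nu}}$ the integral defining $P_\omega f(z)$ converges absolutely for all $z\in\mathbb{D}$ and $P_\omega f\in\mathcal{B}^\infty_{\widehat{\nu}}$, and there is a constant $C\geq 0$ with $\|P_\omega f\|_{\mathcal{B}^\infty_{\widehat{\nu}}}\le C\|f\|_{\infty,\widehat{\nu}}$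 for all $f\in L^\infty_{\widehat{\nu}}$. **Theorem.** Let $\omega$ be a radial weight and $\nu\in\widehat{\mathcal{D}}$. Then the following conditions are equivalent: (i) $P_\omega:L^\infty_{\widehat{\nu}}\to\mathcal{B}^\infty_{\widehat{\nu}}$ is bounded; (ii) $\displaystyle\sup_{x\ge 0}\frac{\nu_x}{\omega_{2x}}\left(\frac{\omega}{\widehat{\nu}}\right)_x<\infty$; (iii) $\omega\in\widehat{\mathcal{D}}$ and $\displaystyle\sup_{0\le r<1}\frac{\widehat{\nu}(r)}{\widehat{\omega}(r)}\int_r^1\frac{\omega(s)}{\widehat{\nu}(s)}\,ds<\infty$. -/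

import Mathlib

open MeasureTheory Filter Topology
open scoped ENNReal NNReal ComplexConjugate

noncomputable section

namespace GrowthBergman

/-- The open unit disc `𝔻`. -/
def disc : Set ℂ := Metric.ball 0 1

/-- The normalized area measure `dA = dx dy / π` on the unit disc. -/
def area : Measure ℂ := (ENNReal.ofReal Real.pi)⁻¹ • (volume.restrict disc)

/-- The moment `ω_x = ∫₀¹ s ^ x ω(s) ds` of a nonnegative function on `[0,1)`, as a number in
`[0, ∞]`. -/
def moment (ω : ℝ → ℝ) (x : ℝ) : ℝ≥0∞ :=
  ∫⁻ s in Set.Ico (0 : ℝ) 1, ENNReal.ofReal (s ^ x * ω s)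

/-- The tail integral `∫_r¹ ω(s) ds` of a nonnegative function on `[0,1)`, as a number in
`[0, ∞]`. -/
def tail (ω : ℝ → ℝ) (r : ℝ) : ℝ≥0∞ :=
  ∫⁻ s in Set.Ico r 1, ENNReal.ofReal (ω s)

/-- A radial weight on the disc, given by its profile: a nonnegative function `ω ∈ L¹([0,1))`
all of whose tail integrals `∫_r¹ ω(s) ds`, `0 ≤ r < 1`, are positive. The weight on the disc is
`z ↦ ω ‖z‖`; the values of `ω` outside `[0,1)` play no role. -/
structure IsRadialWeight (ω : ℝ → ℝ) : Prop where
  nonneg : ∀ s ∈ Set.Ico (0 : ℝ) 1, 0 ≤ ω s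
  integrable : IntegrableOn ω (Set.Ico 0 1)
  tail_pos : ∀ r ∈ Set.Ico (0 : ℝ) 1, 0 < tail ω r

/-- The (real-valued) tail function `ω̂(r) = ∫_r¹ ω(s) ds` of a radial weight. -/
def hat (ω : ℝ → ℝ) (r : ℝ) : ℝ := (tail ω r).toReal

/-- The class of upper doubling radial weights: `ω̂(r) ≤ C ω̂((1+r)/2)` as `r → 1⁻`. -/
def UpperDoubling (ω : ℝ → ℝ) : Prop :=
  IsRadialWeight ω ∧ ∃ C : ℝ, 0 < C ∧ ∀ᶠ r in 𝓝[<] (1 : ℝ), hat ω r ≤ C * hat ω ((1 + r) / 2)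

/-- The reproducing kernel `B_z^ω(ζ) = ∑ (z̄ ζ)ⁿ / (2 ω_{2n+1})` of the weighted Bergman space
`A²_ω` (see `bergmanKernel_reproducing`). -/
def bergmanKernel (ω : ℝ → ℝ) (z ζ : ℂ) : ℂ :=
  ∑' n : ℕ, (conj z * ζ) ^ n / ((2 * (moment ω (2 * n + 1)).toReal : ℝ) : ℂ)

/-- The integrand `f(ζ) * conj (B_z^ω(ζ)) * ω(ζ)` of the Bergman projection. -/
def projIntegrand (ω : ℝ → ℝ) (f : ℂ → ℂ) (z ζ : ℂ) : ℂ :=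
  f ζ * conj (bergmanKernel ω z ζ) * (ω ‖ζ‖ : ℂ)

/-- The Bergman projection `P_ω f(z) = ∫_𝔻 f(ζ) conj (B_z^ω(ζ)) ω(ζ) dA(ζ)`. -/
def bergmanProj (ω : ℝ → ℝ) (f : ℂ → ℂ) (z : ℂ) : ℂ :=
  ∫ ζ, projIntegrand ω f z ζ ∂area

/-- The norm `ess sup_{z ∈ 𝔻} |f(z)| v(z)` of the growth space `L^∞_v`, `v` radial. -/
def growthNorm (v : ℝ → ℝ) (f : ℂ → ℂ) : ℝ≥0∞ :=
  essSup (fun z => ‖f z‖ₑ * ENNReal.ofReal (v ‖z‖)) area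

/-- Membership in the growth space `L^∞_v`. -/
def MemGrowth (v : ℝ → ℝ) (f : ℂ → ℂ) : Prop :=
  AEStronglyMeasurable f area ∧ growthNorm v f < ∞

/-- The quantity `sup_{z ∈ 𝔻} (1 - |z|) v(z) |f'(z)|` defining the Bloch type space `B^∞_v`. -/
def blochNorm (v : ℝ → ℝ) (f : ℂ → ℂ) : ℝ≥0∞ :=
  ⨆ z ∈ disc, ENNReal.ofReal ((1 - ‖z‖) * v ‖z‖ * ‖deriv f z‖)

/-- Membership in the Bloch type space `B^∞_v`. -/
def MemBloch (v : ℝ → ℝ) (f : ℂ → ℂ) : Prop :=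
  DifferentiableOn ℂ f disc ∧ blochNorm v f < ∞

/-- `P_ω : L^∞_v → B^∞_v` is (well defined and) bounded: for all `f ∈ L^∞_v` the integral defining
`P_ω f(z)` converges absolutely at every `z ∈ 𝔻`, the function `P_ω f` belongs to `B^∞_v`, and its
norm is at most a constant times the norm of `f`. -/
def BoundedGrowthToBloch (ω v : ℝ → ℝ) : Prop :=
  ∃ C : ℝ≥0, ∀ f : ℂ → ℂ, MemGrowth v f →
    (∀ z ∈ disc, Integrable (projIntegrand ω f z) area) ∧
    MemBloch v (bergmanProj ω f) ∧
    blochNorm v (bergmanProj ω f) ≤ C * growthNorm v f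

/-- The moment condition `sup_{x ≥ 0} (ν_x / ω_{2x}) (ω/ν̂)_x < ∞`. -/
def MomentCondition (ω ν : ℝ → ℝ) : Prop :=
  ⨆ x : ℝ, ⨆ _ : 0 ≤ x,
    moment ν x / moment ω (2 * x) * moment (fun s => ω s / hat ν s) x < ∞

/-- The tail condition `sup_{0 ≤ r < 1} (ν̂(r) / ω̂(r)) ∫_r¹ ω(s)/ν̂(s) ds < ∞`. -/
def TailCondition (ω ν : ℝ → ℝ) : Prop :=
  ⨆ r ∈ Set.Ico (0 : ℝ) 1,
    tail ν r / tail ω r * tail (fun s => ω s / hat ν s) r < ∞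

lemma disc_norm {z : ℂ} : z ∈ disc ↔ ‖z‖ < 1 := by simp [disc]

lemma moment_lt_top {ω : ℝ → ℝ} (hω : IsRadialWeight ω) {x : ℝ} (hx : 0 ≤ x) :
    moment ω x < ∞ := by
  have h1 : tail ω 0 < ∞ := by
    have := hω.integrable.lintegral_lt_top
    exact this
  refine lt_of_le_of_lt (setLIntegral_mono' measurableSet_Ico fun s hs => ?_) h1
  refine ENNReal.ofReal_le_ofReal ?_
  exact mul_le_of_le_one_left (hω.nonneg s hs) (Real.rpow_le_one hs.1 hs.2.le hx)

lemma moment_lower {ω : ℝ → ℝ} {x r : ℝ} (hx : 0 ≤ x) (hr : r ∈ Set.Ico (0 : ℝ) 1)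
    (hω : IsRadialWeight ω) :
    ENNReal.ofReal (r ^ x) * tail ω r ≤ moment ω x := by
  unfold tail moment
  rw [← lintegral_const_mul' _ _ ENNReal.ofReal_ne_top]
  refine le_trans (setLIntegral_mono' (g := fun s => ENNReal.ofReal (s ^ x * ω s))
    measurableSet_Ico fun s hs => ?_) (lintegral_mono_set (Set.Ico_subset_Ico_left hr.1))
  rw [← ENNReal.ofReal_mul (Real.rpow_nonneg hr.1 x)]
  exact ENNReal.ofReal_le_ofReal (mul_le_mul_of_nonneg_right
    (Real.rpow_le_rpow hr.1 hs.1 hx) (hω.nonneg s ⟨hr.1.trans hs.1, hs.2⟩))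


lemma momentReal_pos {ω : ℝ → ℝ} (hω : IsRadialWeight ω) {x : ℝ} (hx : 0 ≤ x) :
    0 < (moment ω x).toReal := by
  refine ENNReal.toReal_pos ?_ (moment_lt_top hω hx).ne
  have := moment_lower hx (r := 1/2) ⟨by norm_num, by norm_num⟩ hω
  refine (lt_of_lt_of_le ?_ this).ne'
  exact ENNReal.mul_pos (by simpa using Real.rpow_pos_of_pos (by norm_num) x)
    (hω.tail_pos _ ⟨by norm_num, by norm_num⟩).ne'

lemma momentReal_lower {ω : ℝ → ℝ} {x r : ℝ} (hx : 0 ≤ x) (hr : r ∈ Set.Ico (0 : ℝ) 1)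
    (hω : IsRadialWeight ω) : r ^ x * hat ω r ≤ (moment ω x).toReal := by
  have := ENNReal.toReal_mono (moment_lt_top hω hx).ne (moment_lower hx hr hω)
  rwa [ENNReal.toReal_mul, ENNReal.toReal_ofReal (Real.rpow_nonneg hr.1 x)] at this

lemma hat_pos {ω : ℝ → ℝ} (hω : IsRadialWeight ω) {r : ℝ} (hr : r ∈ Set.Ico (0 : ℝ) 1) :
    0 < hat ω r := by
  refine ENNReal.toReal_pos (hω.tail_pos r hr).ne' (lt_of_le_of_lt ?_
    (hω.integrable.lintegral_lt_top)).ne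
  exact lintegral_mono_set (Set.Ico_subset_Ico_left hr.1)

lemma summable_coeff {ω : ℝ → ℝ} (hω : IsRadialWeight ω) {t : ℝ} (ht0 : 0 ≤ t) (ht : t < 1) :
    Summable fun n : ℕ => t ^ n / (2 * (moment ω (2 * n + 1)).toReal) := by
  obtain ⟨r, hr0, hr1, hrt⟩ : ∃ r : ℝ, 0 < r ∧ r < 1 ∧ t < r ^ 2 := by
    refine ⟨Real.sqrt ((1 + t) / 2), Real.sqrt_pos.2 (by linarith), ?_, ?_⟩
    · rw [Real.sqrt_lt' one_pos]; linarith
    · rw [Real.sq_sqrt (by linarith)]; linarith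
  have hr : r ∈ Set.Ico (0 : ℝ) 1 := ⟨hr0.le, hr1⟩
  have hh := hat_pos hω hr
  have hg : Summable fun n : ℕ => (t / r ^ 2) ^ n * (1 / (2 * r * hat ω r)) :=
    (summable_geometric_of_lt_one (by positivity)
      ((div_lt_one (by positivity)).2 hrt)).mul_right _
  refine Summable.of_nonneg_of_le (fun n => by positivity) (fun n => ?_) hg
  have hx : (0 : ℝ) ≤ 2 * n + 1 := by positivity
  have h1 := momentReal_lower hx hr hω
  have h2 : r ^ (2 * (n : ℝ) + 1) = (r ^ 2) ^ n * r := by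
    rw [Real.rpow_add hr0, Real.rpow_one, ← pow_mul]
    congr 1
    exact_mod_cast Real.rpow_natCast r (2 * n)
  rw [h2] at h1
  calc t ^ n / (2 * (moment ω (2 * n + 1)).toReal)
      ≤ t ^ n / (2 * ((r ^ 2) ^ n * r * hat ω r)) := by gcongr
    _ = _ := by rw [div_pow]; field_simp

/-- Radial weights are integrable over the disc. -/
lemma integrable_weight {ω : ℝ → ℝ} (hω : IsRadialWeight ω) :
    Integrable (fun ζ : ℂ => ω ‖ζ‖) area := by
  unfold area
  refine Integrable.smul_measure ?_ (by simp [Real.pi_pos])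
  have h := integrable_fun_norm_addHaar (volume : Measure ℂ)
    (f := (Set.Ico (0 : ℝ) 1).indicator ω)
  rw [Complex.finrank_real_complex] at h
  have h2 : Integrable (fun x : ℂ => (Set.Ico (0 : ℝ) 1).indicator ω ‖x‖) := by
    rw [h]
    have h3 : IntegrableOn (fun y : ℝ => y ^ (2 - 1) • ω y) (Set.Ico 0 1) := by
      refine Integrable.bdd_mul (c := 1) hω.integrable (by fun_prop) ?_
      refine (ae_restrict_iff' measurableSet_Ico).2 (ae_of_all _ fun y hy => ?_)
      simpa [abs_of_nonneg hy.1] using hy.2.le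
    rw [← integrable_indicator_iff measurableSet_Ico] at h3
    refine (h3.congr (ae_of_all _ fun y => ?_)).integrableOn
    by_cases hy : y ∈ Set.Ico (0 : ℝ) 1 <;> simp [hy]
  refine (h2.integrableOn (s := disc)).congr ?_
  refine (ae_restrict_iff' Metric.isOpen_ball.measurableSet).2 (ae_of_all _ fun z hz => ?_)
  have : ‖z‖ < 1 := disc_norm.1 hz
  simp [this]

lemma ae_area {p : ℂ → Prop} (h : ∀ z ∈ disc, p z) : (∀ᵐ z ∂area, p z) := by
  unfold area
  refine Measure.ae_smul_measure ?_ _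
  exact (ae_restrict_iff' Metric.isOpen_ball.measurableSet).2 (ae_of_all _ h)

lemma aesm_area {f : ℂ → ℂ} (hf : ContinuousOn f disc) : AEStronglyMeasurable f area := by
  unfold area
  exact (hf.aestronglyMeasurable Metric.isOpen_ball.measurableSet).smul_measure _

lemma norm_term_le {ω : ℝ → ℝ} {z ζ : ℂ} (hζ : ζ ∈ disc) (n : ℕ) :
    ‖(conj z * ζ) ^ n / ((2 * (moment ω (2 * n + 1)).toReal : ℝ) : ℂ)‖ ≤
      ‖z‖ ^ n / (2 * (moment ω (2 * n + 1)).toReal) := by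
  rw [norm_div, Complex.norm_real, Real.norm_of_nonneg (by positivity), norm_pow, norm_mul,
    RCLike.norm_conj]
  gcongr
  exact mul_le_of_le_one_right (norm_nonneg _) (disc_norm.1 hζ).le

lemma kernel_differentiableOn {ω : ℝ → ℝ} (hω : IsRadialWeight ω) {z : ℂ} (hz : z ∈ disc) :
    DifferentiableOn ℂ (bergmanKernel ω z) disc := by
  unfold bergmanKernel
  exact Complex.differentiableOn_tsum_of_summable_norm
    (summable_coeff hω (norm_nonneg z) (disc_norm.1 hz)) (fun n => by fun_prop)
    Metric.isOpen_ball (fun n ζ hζ => norm_term_le hζ n)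

lemma kernel_bounded {ω : ℝ → ℝ} (hω : IsRadialWeight ω) {z : ℂ} (hz : z ∈ disc) :
    ∃ K : ℝ, ∀ ζ ∈ disc, ‖bergmanKernel ω z ζ‖ ≤ K :=
  ⟨_, fun _ hζ => tsum_of_norm_bounded
    (summable_coeff hω (norm_nonneg z) (disc_norm.1 hz)).hasSum (fun n => norm_term_le hζ n)⟩

lemma integral_area {F : ℂ → ℂ} (hF : Integrable F area) :
    ∫ ζ, F ζ ∂area = ((Real.pi : ℂ))⁻¹ * ∫ r in Set.Ioo (0 : ℝ) 1, ∫ θ in Set.Ioo (-Real.pi) Real.pi,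
      (r : ℂ) * F (circleMap 0 r θ) := by
  have hpi := Real.pi_pos
  have hF' : IntegrableOn F disc := by
    unfold area at hF
    rw [integrable_smul_measure (by simp) (by simp [hpi])] at hF
    exact hF
  have hG : Integrable (disc.indicator F) :=
    (integrable_indicator_iff Metric.isOpen_ball.measurableSet).2 hF'
  have h1 : ∫ ζ, F ζ ∂area = ((Real.pi : ℂ))⁻¹ * ∫ ζ, disc.indicator F ζ := by
    unfold area
    rw [integral_smul_measure, integral_indicator (show MeasurableSet disc from
      Metric.isOpen_ball.measurableSet)]
    simp [ENNReal.toReal_ofReal hpi.le, Complex.real_smul]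
  rw [h1, ← Complex.integral_comp_polarCoord_symm]
  congr 1
  have hmeas : MeasurableSet polarCoord.target := polarCoord.open_target.measurableSet
  have hint : IntegrableOn (fun p : ℝ × ℝ => p.1 • disc.indicator F (Complex.polarCoord.symm p))
      polarCoord.target := by
    have h2 : Integrable (fun p : ℝ × ℝ =>
        disc.indicator F (Complex.measurableEquivRealProd.symm p)) :=
      (Complex.volume_preserving_equiv_real_prod.symm.integrable_comp_emb
        Complex.measurableEquivRealProd.symm.measurableEmbedding).2 hG
    have h3 := (integrableOn_image_iff_integrableOn_abs_det_fderiv_smul volume hmeas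
      (fun p _ => (hasFDerivAt_polarCoord_symm p).hasFDerivWithinAt)
      (polarCoord.symm.injOn) (fun p : ℝ × ℝ =>
        disc.indicator F (Complex.measurableEquivRealProd.symm p))).1 h2.integrableOn
    refine h3.congr_fun (fun p hp => ?_) hmeas
    simp only [det_fderivPolarCoordSymm]
    rw [abs_of_pos hp.1, Complex.measurableEquivRealProd_symm_polarCoord_symm_apply]
  have ht : polarCoord.target = Set.Ioi (0 : ℝ) ×ˢ Set.Ioo (-Real.pi) Real.pi := rfl
  rw [ht, Measure.volume_eq_prod] at hint
  rw [ht, Measure.volume_eq_prod, setIntegral_prod _ hint]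
  have hsub : Set.Ioo (0 : ℝ) 1 ⊆ Set.Ioi 0 := Set.Ioo_subset_Ioi_self
  have hval : ∀ r θ : ℝ, Complex.polarCoord.symm (r, θ) = circleMap 0 r θ := by
    intro r θ
    simp [circleMap, Complex.exp_mul_I]
  rw [setIntegral_eq_of_subset_of_forall_sdiff_eq_zero measurableSet_Ioi hsub]
  · refine setIntegral_congr_fun measurableSet_Ioo fun r hr => ?_
    refine integral_congr_ae (ae_of_all _ fun θ => ?_)
    have : circleMap 0 r θ ∈ disc := by
      rw [disc_norm, norm_circleMap_zero, abs_of_pos hr.1]; exact hr.2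
    simp only [hval, Set.indicator_of_mem this, Complex.real_smul]
  · intro r hr
    refine (integral_congr_ae (ae_of_all _ fun θ => ?_)).trans (integral_zero' ℝ ℂ)
    have hr0 : (0 : ℝ) < r := hr.1
    have : circleMap 0 r θ ∉ disc := by
      rw [disc_norm, norm_circleMap_zero, abs_of_pos hr0]
      intro h
      exact hr.2 ⟨hr0, h⟩
    simp only [hval, Set.indicator_of_notMem this, smul_zero, Pi.zero_apply]

lemma angular {f : ℂ → ℂ} (hf : DifferentiableOn ℂ f disc) (n : ℕ) {r : ℝ}
    (hr : r ∈ Set.Ioo (0 : ℝ) 1) :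
    ∫ θ in Set.Ioo (-Real.pi) Real.pi, f (circleMap 0 r θ) * conj (circleMap 0 r θ) ^ n =
      2 * Real.pi * (r : ℂ) ^ (2 * n) * (iteratedDeriv n f 0 / n.factorial) := by
  have hc := (hf.mono (Metric.closedBall_subset_ball hr.2)).circleIntegral_one_div_sub_center_pow_smul
    hr.1 n
  have hr0 : (r : ℂ) ≠ 0 := by exact_mod_cast hr.1.ne'
  have hper : Function.Periodic (fun θ => f (circleMap 0 r θ) * conj (circleMap 0 r θ) ^ n)
      (2 * Real.pi) := fun θ => by simp only [periodic_circleMap 0 r θ]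
  rw [← integral_Ioc_eq_integral_Ioo, ← intervalIntegral.integral_of_le (by linarith [Real.pi_pos])]
  have h1 := hper.intervalIntegral_add_eq (-Real.pi) 0
  rw [show -Real.pi + 2 * Real.pi = Real.pi by ring, zero_add] at h1
  rw [h1]
  have h2 : ∀ θ : ℝ, f (circleMap 0 r θ) * conj (circleMap 0 r θ) ^ n =
      ((r : ℂ) ^ (2 * n) * Complex.I⁻¹) * (deriv (circleMap 0 r) θ •
        ((1 / (circleMap 0 r θ - 0) ^ (n + 1)) • f (circleMap 0 r θ))) := by
    intro θ
    have hne : circleMap 0 r θ ≠ 0 := circleMap_ne_center hr.1.ne'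
    have hcj : conj (circleMap 0 r θ) = (r : ℂ) ^ 2 / circleMap 0 r θ := by
      rw [eq_div_iff hne, mul_comm, Complex.mul_conj, Complex.normSq_eq_norm_sq,
        norm_circleMap_zero, sq_abs]
      push_cast; rfl
    rw [hcj, deriv_circleMap, div_pow, ← pow_mul, pow_succ]
    simp only [smul_eq_mul, sub_zero]
    have hI := Complex.I_ne_zero
    field_simp
  simp_rw [h2]
  rw [intervalIntegral.integral_const_mul]
  unfold circleIntegral at hc
  rw [hc]
  have hI := Complex.I_ne_zero
  simp only [smul_eq_mul]
  field_simp

lemma integrable_pow_mul {ω : ℝ → ℝ} {f : ℂ → ℂ}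
    (hfi : Integrable (fun ζ => f ζ * (ω ‖ζ‖ : ℂ)) area) (n : ℕ) :
    Integrable (fun ζ => f ζ * conj ζ ^ n * (ω ‖ζ‖ : ℂ)) area := by
  refine (Integrable.bdd_mul (f := fun ζ : ℂ => conj ζ ^ n) (c := 1) hfi
    (Continuous.aestronglyMeasurable (by fun_prop)) (ae_area fun ζ hζ => ?_)).congr
    (ae_of_all _ fun ζ => by ring)
  rw [norm_pow, RCLike.norm_conj]
  exact pow_le_one₀ (norm_nonneg _) (disc_norm.1 hζ).le

lemma integral_pow {ω : ℝ → ℝ} (hω : IsRadialWeight ω) {f : ℂ → ℂ}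
    (hf : DifferentiableOn ℂ f disc)
    (hfi : Integrable (fun ζ => f ζ * (ω ‖ζ‖ : ℂ)) area) (n : ℕ) :
    ∫ ζ, f ζ * conj ζ ^ n * (ω ‖ζ‖ : ℂ) ∂area =
      ((2 * (moment ω (2 * n + 1)).toReal : ℝ) : ℂ) * (iteratedDeriv n f 0 / n.factorial) := by
  rw [integral_area (integrable_pow_mul hfi n)]
  have h1 : ∀ r ∈ Set.Ioo (0 : ℝ) 1, ∫ θ in Set.Ioo (-Real.pi) Real.pi, (r : ℂ) *
      (f (circleMap 0 r θ) * conj (circleMap 0 r θ) ^ n * (ω ‖circleMap 0 r θ‖ : ℂ)) =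
      ((r ^ (2 * (n : ℝ) + 1) * ω r : ℝ) : ℂ) *
        (2 * Real.pi * (iteratedDeriv n f 0 / n.factorial)) := by
    intro r hr
    have h2 : ∀ θ : ℝ, (r : ℂ) *
      (f (circleMap 0 r θ) * conj (circleMap 0 r θ) ^ n * (ω ‖circleMap 0 r θ‖ : ℂ)) =
      ((r : ℂ) * ω r) * (f (circleMap 0 r θ) * conj (circleMap 0 r θ) ^ n) := by
      intro θ
      rw [norm_circleMap_zero, abs_of_pos hr.1]; ring
    simp_rw [h2]
    rw [integral_const_mul, angular hf n hr]
    have h3 : r ^ (2 * (n : ℝ) + 1) = r ^ (2 * n) * r := by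
      rw [Real.rpow_add hr.1, Real.rpow_one]
      congr 1
      exact_mod_cast Real.rpow_natCast r (2 * n)
    rw [h3]; push_cast; ring
  rw [setIntegral_congr_fun measurableSet_Ioo h1, integral_mul_const]
  rw [show (∫ r in Set.Ioo (0 : ℝ) 1, ((r ^ (2 * (n : ℝ) + 1) * ω r : ℝ) : ℂ)) =
    ((∫ r in Set.Ioo (0 : ℝ) 1, r ^ (2 * (n : ℝ) + 1) * ω r : ℝ) : ℂ) from integral_ofReal]
  have h4 : ∫ r in Set.Ioo (0 : ℝ) 1, r ^ (2 * (n : ℝ) + 1) * ω r =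
      (moment ω (2 * n + 1)).toReal := by
    rw [← integral_Ico_eq_integral_Ioo, integral_eq_lintegral_of_nonneg_ae]
    · rfl
    · exact (ae_restrict_iff' measurableSet_Ico).2 (ae_of_all _ fun r hr =>
        mul_nonneg (Real.rpow_nonneg hr.1 _) (hω.nonneg r hr))
    · exact (Measurable.aestronglyMeasurable (by fun_prop)).mul hω.integrable.1
  rw [h4]
  have : (Real.pi : ℂ) ≠ 0 := by exact_mod_cast Real.pi_ne_zero
  push_cast
  field_simp

/-- `bergmanKernel ω` is the reproducing kernel of the weighted Bergman space `A²_ω` of analytic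
functions `f` on the disc with `∫ |f|² ω dA < ∞`. -/
theorem bergmanKernel_reproducing {ω : ℝ → ℝ} (hω : IsRadialWeight ω) {z : ℂ} (hz : z ∈ disc) :
    DifferentiableOn ℂ (bergmanKernel ω z) disc ∧
    Integrable (fun ζ => ‖bergmanKernel ω z ζ‖ ^ 2 * ω ‖ζ‖) area ∧
    ∀ f : ℂ → ℂ, DifferentiableOn ℂ f disc →
      Integrable (fun ζ => ‖f ζ‖ ^ 2 * ω ‖ζ‖) area → bergmanProj ω f z = f z := by
  have hd := kernel_differentiableOn hω hz
  obtain ⟨K, hK⟩ := kernel_bounded hω hz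
  have hw := integrable_weight hω
  refine ⟨hd, ?_, fun f hf hf2 => ?_⟩
  · refine Integrable.bdd_mul (c := K ^ 2) hw ?_ (ae_area fun ζ hζ => ?_)
    · exact (aesm_area hd.continuousOn).norm.pow 2
    · rw [norm_pow, norm_norm]
      exact pow_le_pow_left₀ (norm_nonneg _) (hK ζ hζ) 2
  · have hfi : Integrable (fun ζ => f ζ * (ω ‖ζ‖ : ℂ)) area := by
      refine (hw.add hf2).mono' ((aesm_area hf.continuousOn).mul
        (Complex.continuous_ofReal.comp_aestronglyMeasurable hw.1)) (ae_area fun ζ hζ => ?_)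
      have h0 := hω.nonneg ‖ζ‖ ⟨norm_nonneg _, disc_norm.1 hζ⟩
      rw [norm_mul, Complex.norm_real, Real.norm_of_nonneg h0]
      simp only [Pi.add_apply]
      nlinarith [mul_nonneg h0 (sq_nonneg (‖f ζ‖ - 1)), mul_nonneg h0 (sq_nonneg (‖f ζ‖))]
    set m : ℕ → ℂ := fun n => ((2 * (moment ω (2 * n + 1)).toReal : ℝ) : ℂ) with hm
    have hm0 : ∀ n, m n ≠ 0 := fun n => by
      have := momentReal_pos hω (x := 2 * n + 1) (by positivity)
      simp only [hm]
      exact_mod_cast (by positivity : 2 * (moment ω (2 * n + 1)).toReal ≠ 0)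
    let F : ℕ → ℂ → ℂ := fun n ζ => z ^ n / m n * (f ζ * conj ζ ^ n * (ω ‖ζ‖ : ℂ))
    have hFi : ∀ n, Integrable (F n) area := fun n => (integrable_pow_mul hfi n).const_mul _
    have hFs : Summable fun n => ∫ ζ, ‖F n ζ‖ ∂area := by
      refine Summable.of_nonneg_of_le (fun n => integral_nonneg fun ζ => norm_nonneg _)
        (fun n => ?_) ((summable_coeff hω (norm_nonneg z) (disc_norm.1 hz)).mul_right
          (∫ ζ, ‖f ζ * (ω ‖ζ‖ : ℂ)‖ ∂area))
      rw [← integral_const_mul]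
      refine integral_mono_ae (hFi n).norm (hfi.norm.const_mul _) (ae_area fun ζ hζ => ?_)
      simp only [F, norm_mul, norm_div, norm_pow, RCLike.norm_conj, hm]
      rw [Complex.norm_real (2 * _), Real.norm_of_nonneg (by positivity : 0 ≤ 2 * (moment ω (2 * n + 1)).toReal)]
      refine mul_le_mul_of_nonneg_left ?_ (by positivity)
      refine mul_le_mul_of_nonneg_right ?_ (norm_nonneg _)
      exact mul_le_of_le_one_right (norm_nonneg _)
        (pow_le_one₀ (norm_nonneg _) (disc_norm.1 hζ).le)
    have hS := hasSum_integral_of_summable_integral_norm hFi hFs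
    have hT := Complex.hasSum_taylorSeries_on_ball (c := 0) (r := 1) hf hz
    have he : ∀ n, ∫ ζ, F n ζ ∂area =
        (n.factorial : ℂ)⁻¹ • (z - 0) ^ n • iteratedDeriv n f 0 := by
      intro n
      simp only [F]
      rw [integral_const_mul, integral_pow hω hf hfi n, sub_zero, smul_eq_mul, smul_eq_mul]
      have := hm0 n
      change z ^ n / m n * (m n * _) = _
      field_simp
    rw [funext he] at hS
    rw [← hS.unique hT]
    refine integral_congr_ae (ae_of_all _ fun ζ => ?_)
    simp only [projIntegrand, bergmanKernel, F]
    rw [Complex.conj_tsum, tsum_mul_left.symm, tsum_mul_right.symm]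
    refine tsum_congr fun n => ?_
    simp only [map_div₀, map_pow, map_mul, Complex.conj_conj, Complex.conj_ofReal, mul_pow, hm]
    ring

end GrowthBergman

end

noncomputable section

namespace GrowthBergman

/-! Write σ = ω/ν̂ and k(u) = ∑ uⁿ/(2ω_{2n+1}), so that P_ω integrates fω against k(zζ̄). The
dictionary behind everything is that a radial weight is upper doubling exactly when its moments
satisfy ω_x ≤ C ω_{2x}, and that then ω_x and ω̂(r) are comparable for x = 1/(1-r), r ≥ 1/2
(`mom_le_mom_two_mul`, `exists_mom_le_hat`, `exp_neg_two_le`).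

Boundedness gives the moment condition by testing on f = (ζ/|ζ|)ⁿ/ν̂, which has norm at most 1. By
orthogonality P_ω f = (σ_{n+1}/ω_{2n+1}) zⁿ (`bergmanProj_testFun`). The Bloch quantity at |z| = 1 -
1/n bounds ν̂(1 - 1/n) σ_{n+1}/ω_{2n+1}, and doubling of ν replaces ν̂(1 - 1/n) by ν_n.

The moment condition gives the third one as follows. Since s^y ν̂(s) ≤ ν_y, one has ω_{x+y} ≤ ν_y
σ_x. Used with the exponents x/3 and 2x/3, together with doubling of ν and the hypothesis, this
yields ω_x ≤ C ω_{4x/3}, hence doubling of ω. The tail condition is then the moment condition read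
at x = 1/(1-r).

For the return to boundedness, differentiate under the integral. It remains to bound ∫ σ(ζ)|k'(zζ̄)|
dA by a constant times 1/((1-|z|)ν̂(z)). The core is the circle mean ∫|k'| ≲ 1/((1-ρ)ω̂(ρ)) on
radius ρ (`exists_integral_norm_deriv_kern_le`): factor k' as (1-u)k' times (1-u)⁻¹ and use L²
norms. The factor 1-u differences the coefficients n/(2ω_{2n+1}) of k', and doubling brings the
differences down to order 1/ω_{2n}. The remaining radial integral is split at |z|, with doubling of
ω controlling the inner part and the tail condition the outer part (`exists_radial_lintegral_le`).
-/

/-- The moment `ω_x` as a real number. -/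
abbrev mom (ω : ℝ → ℝ) (x : ℝ) : ℝ := (moment ω x).toReal

/-! ### Finiteness and monotonicity of tails and moments -/

lemma tail_lt_top {ω : ℝ → ℝ} (hω : IsRadialWeight ω) {r : ℝ} (hr : 0 ≤ r) : tail ω r < ∞ :=
  lt_of_le_of_lt (lintegral_mono_set (Set.Ico_subset_Ico_left hr))
    hω.integrable.lintegral_lt_top

lemma ofReal_hat {ω : ℝ → ℝ} (hω : IsRadialWeight ω) {r : ℝ} (hr : 0 ≤ r) :
    ENNReal.ofReal (hat ω r) = tail ω r :=
  ENNReal.ofReal_toReal (tail_lt_top hω hr).ne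

lemma ofReal_mom {ω : ℝ → ℝ} (hω : IsRadialWeight ω) {x : ℝ} (hx : 0 ≤ x) :
    ENNReal.ofReal (mom ω x) = moment ω x :=
  ENNReal.ofReal_toReal (moment_lt_top hω hx).ne

lemma tail_anti (ω : ℝ → ℝ) : Antitone (tail ω) := fun _ _ h =>
  lintegral_mono_set (Set.Ico_subset_Ico_left h)

lemma hat_anti {ω : ℝ → ℝ} (hω : IsRadialWeight ω) {r s : ℝ} (hr : 0 ≤ r) (hrs : r ≤ s) :
    hat ω s ≤ hat ω r :=
  ENNReal.toReal_mono (tail_lt_top hω hr).ne (tail_anti ω hrs)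

lemma hat_nonneg (ω : ℝ → ℝ) (r : ℝ) : 0 ≤ hat ω r := ENNReal.toReal_nonneg

lemma measurable_tail (ω : ℝ → ℝ) : Measurable (tail ω) := (tail_anti ω).measurable

lemma measurable_hat (ω : ℝ → ℝ) : Measurable (hat ω) := (measurable_tail ω).ennreal_toReal

lemma moment_anti {ω : ℝ → ℝ} (hω : IsRadialWeight ω) {x y : ℝ} (hxy : x ≤ y) :
    moment ω y ≤ moment ω x := by
  refine setLIntegral_mono_ae' measurableSet_Ico ?_
  have h0 : ∀ᵐ s : ℝ, s ≠ 0 := by simp [ae_iff]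
  filter_upwards [h0] with s hs0 hs
  refine ENNReal.ofReal_le_ofReal (mul_le_mul_of_nonneg_right ?_ (hω.nonneg s hs))
  exact Real.rpow_le_rpow_of_exponent_ge (lt_of_le_of_ne hs.1 hs0.symm) hs.2.le hxy

lemma mom_anti {ω : ℝ → ℝ} (hω : IsRadialWeight ω) {x y : ℝ} (hx : 0 ≤ x) (hxy : x ≤ y) :
    mom ω y ≤ mom ω x :=
  ENNReal.toReal_mono (moment_lt_top hω hx).ne (moment_anti hω hxy)

/-! ### Doubling of tails and doubling of moments -/

/-- The doubling inequality of an upper doubling weight holds on all of `[0,1)`. -/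
lemma UpperDoubling.exists_const {ω : ℝ → ℝ} (h : UpperDoubling ω) :
    ∃ C : ℝ, 0 < C ∧ ∀ r ∈ Set.Ico (0 : ℝ) 1, hat ω r ≤ C * hat ω ((1 + r) / 2) := by
  obtain ⟨hω, C, hC, hev⟩ := h
  obtain ⟨a, ha, hev⟩ := (mem_nhdsLT_iff_exists_Ioo_subset' (show (0 : ℝ) < 1 by norm_num)).1 hev
  set b := max a 0 with hb
  have hb0 : 0 ≤ b := le_max_right _ _
  have hb1 : b < 1 := max_lt ha one_pos
  have hp := hat_pos hω (r := (1 + b) / 2) ⟨by linarith, by linarith⟩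
  have hp0 := hat_pos hω (r := 0) ⟨le_rfl, one_pos⟩
  -- On the remaining range [0, b] the tail lies between its values at (1+b)/2 and 0, so the second
  -- constant suffices.
  refine ⟨max C (hat ω 0 / hat ω ((1 + b) / 2)), lt_max_of_lt_left hC, fun r hr => ?_⟩
  have hr1 := hr.1
  have hr2 := hr.2
  by_cases hrb : b < r
  · refine (hev ⟨(le_max_left _ _).trans_lt hrb, hr2⟩).trans ?_
    exact mul_le_mul_of_nonneg_right (le_max_left _ _) (hat_nonneg _ _)
  · push Not at hrb
    calc hat ω r ≤ hat ω 0 := hat_anti hω le_rfl hr1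
      _ = hat ω 0 / hat ω ((1 + b) / 2) * hat ω ((1 + b) / 2) := by field_simp
      _ ≤ _ := mul_le_mul (le_max_right _ _) (hat_anti hω (by linarith) (by linarith))
          hp.le (le_max_of_le_left hC.le)

/-- For s > 1/2 one has s^x ≤ 2 s^(x+1). The mass on s ≤ 1/2 contributes at most 2^(-x) ω̂(0), which
is absorbed by ω_{x+1} ≥ 2^(-x-1) ω̂(1/2). No doubling is needed, so bounded shifts of the exponent
are harmless for every radial weight. -/
lemma exists_mom_le_mom_add_one {ω : ℝ → ℝ} (hω : IsRadialWeight ω) :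
    ∃ S : ℝ, 1 ≤ S ∧ ∀ x : ℝ, 0 ≤ x → mom ω x ≤ S * mom ω (x + 1) := by
  have hp := hat_pos hω (r := 1 / 2) ⟨by norm_num, by norm_num⟩
  have hp0 := hat_pos hω (r := 0) ⟨le_rfl, one_pos⟩
  refine ⟨2 * hat ω 0 / hat ω (1 / 2) + 2, by have : 0 ≤ 2 * hat ω 0 / hat ω (1 / 2) := by positivity
                                              linarith, fun x hx => ?_⟩
  have key : moment ω x ≤ ENNReal.ofReal ((1 / 2) ^ x * hat ω 0) + ENNReal.ofReal 2 * moment ω (x + 1) := by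
    rw [ENNReal.ofReal_mul (by positivity), ofReal_hat hω le_rfl]
    unfold moment tail
    rw [← lintegral_const_mul' _ _ ENNReal.ofReal_ne_top,
      ← lintegral_const_mul' _ _ ENNReal.ofReal_ne_top, ← lintegral_add_left']
    · refine setLIntegral_mono' measurableSet_Ico fun s hs => ?_
      have h0 := hω.nonneg s hs
      rw [← ENNReal.ofReal_mul (by positivity), ← ENNReal.ofReal_mul (by positivity),
        ← ENNReal.ofReal_add (by positivity) (mul_nonneg (by norm_num)
          (mul_nonneg (Real.rpow_nonneg hs.1 _) h0))]
      refine ENNReal.ofReal_le_ofReal ?_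
      have hsx := Real.rpow_nonneg hs.1 (x + 1)
      by_cases h : s ≤ 1 / 2
      · have := Real.rpow_le_rpow hs.1 h hx
        nlinarith [mul_le_mul_of_nonneg_right this h0, mul_nonneg hsx h0]
      · push Not at h
        have : s ^ x ≤ 2 * s ^ (x + 1) := by
          rw [Real.rpow_add (by linarith), Real.rpow_one]
          nlinarith [Real.rpow_nonneg hs.1 x]
        have h2 : 0 ≤ (1 / 2 : ℝ) ^ x := by positivity
        nlinarith [mul_le_mul_of_nonneg_right this h0, mul_nonneg h2 h0]
    · exact hω.integrable.aemeasurable.ennreal_ofReal.const_mul _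
  have h2 := ENNReal.toReal_mono (by
    exact ENNReal.add_ne_top.2 ⟨ENNReal.ofReal_ne_top, ENNReal.mul_ne_top ENNReal.ofReal_ne_top
      (moment_lt_top hω (by linarith)).ne⟩) key
  rw [ENNReal.toReal_add ENNReal.ofReal_ne_top (ENNReal.mul_ne_top ENNReal.ofReal_ne_top
      (moment_lt_top hω (by linarith)).ne), ENNReal.toReal_mul,
      ENNReal.toReal_ofReal (by positivity), ENNReal.toReal_ofReal (by norm_num)] at h2
  have h3 := momentReal_lower (x := x + 1) (r := 1 / 2) (by linarith) ⟨by norm_num, by norm_num⟩ hω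
  rw [Real.rpow_add (by norm_num), Real.rpow_one] at h3
  have h4 : (1 / 2 : ℝ) ^ x * hat ω 0 ≤ 2 * hat ω 0 / hat ω (1 / 2) * mom ω (x + 1) := by
    calc (1 / 2 : ℝ) ^ x * hat ω 0
        = 2 * hat ω 0 / hat ω (1 / 2) * ((1 / 2) ^ x * (1 / 2) * hat ω (1 / 2)) := by field_simp
      _ ≤ _ := by gcongr
  linarith

/-- Layer-cake formula for s^x against the measure ω ds: the level set {s^x > t} is, up to an
endpoint, the interval [t^(1/x), 1). -/
lemma moment_eq_lintegral_tail {ω : ℝ → ℝ} (hω : IsRadialWeight ω) {x : ℝ} (hx : 0 < x) :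
    moment ω x = ∫⁻ t in Set.Ioo (0 : ℝ) 1, tail ω (t ^ x⁻¹) := by
  set μ := (volume.restrict (Set.Ico (0 : ℝ) 1)).withDensity fun s => ENNReal.ofReal (ω s) with hμ
  have hmeas : Measurable fun s : ℝ => s ^ x := by fun_prop
  have h1 : moment ω x = ∫⁻ s, ENNReal.ofReal (s ^ x) ∂μ := by
    rw [hμ, lintegral_withDensity_eq_lintegral_mul₀ hω.integrable.aemeasurable.ennreal_ofReal
      (by fun_prop)]
    refine setLIntegral_congr_fun measurableSet_Ico fun s hs => ?_
    simp only [Pi.mul_apply]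
    rw [mul_comm, ENNReal.ofReal_mul (hω.nonneg s hs)]
  have hset : ∀ t : ℝ, 0 < t → μ {s | t < s ^ x} = if t < 1 then tail ω (t ^ x⁻¹) else 0 := by
    intro t ht
    have hm : MeasurableSet {s : ℝ | t < s ^ x} := measurableSet_lt measurable_const hmeas
    rw [hμ, withDensity_apply _ hm, Measure.restrict_restrict hm]
    have hiff : ∀ s ∈ Set.Ico (0 : ℝ) 1, (t < s ^ x ↔ t ^ x⁻¹ < s) := fun s hs =>
      (Real.rpow_inv_lt_iff_of_pos ht.le hs.1 hx).symm
    split_ifs with h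
    · unfold tail
      rw [← setLIntegral_congr (Ioo_ae_eq_Ico (a := t ^ x⁻¹) (b := (1 : ℝ)))]
      congr 2
      ext s
      constructor
      · rintro ⟨h1, h2⟩
        exact ⟨(hiff s h2).1 h1, h2.2⟩
      · rintro ⟨h1, h2⟩
        have h3 : s ∈ Set.Ico (0 : ℝ) 1 := ⟨(Real.rpow_nonneg ht.le _).trans h1.le, h2⟩
        exact ⟨(hiff s h3).2 h1, h3⟩
    · have : {s : ℝ | t < s ^ x} ∩ Set.Ico 0 1 = ∅ := by
        ext s
        simp only [Set.mem_inter_iff, Set.mem_ofPred_eq, Set.mem_empty_iff_false, iff_false]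
        rintro ⟨h1, h2⟩
        have := Real.rpow_le_one h2.1 h2.2.le hx.le
        linarith
      rw [this]; simp
  rw [h1, lintegral_eq_lintegral_meas_lt μ _ hmeas.aemeasurable]
  · rw [← lintegral_indicator measurableSet_Ioo, ← lintegral_indicator measurableSet_Ioi]
    refine lintegral_congr fun t => ?_
    by_cases h0 : 0 < t
    · by_cases h1 : t < 1 <;> simp [h0, h1, hset t h0]
    · simp [h0]
  · refine (withDensity_absolutelyContinuous _ _) ?_
    exact (ae_restrict_iff' measurableSet_Ico).2 (ae_of_all _ fun s hs => Real.rpow_nonneg hs.1 _)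

/-- In the layer-cake formula put u = t^(1/(2x)), so that t^(1/x) = u². Doubling at u² leads to the
point (1+u²)/2 ≥ u, and the tail there is at most ω̂(u), the integrand for 2x. -/
lemma mom_le_mom_two_mul {ω : ℝ → ℝ} (hω : IsRadialWeight ω) {C : ℝ} (hC : 0 < C)
    (h : ∀ r ∈ Set.Ico (0 : ℝ) 1, hat ω r ≤ C * hat ω ((1 + r) / 2)) {x : ℝ} (hx : 0 < x) :
    mom ω x ≤ C * mom ω (2 * x) := by
  have key : moment ω x ≤ ENNReal.ofReal C * moment ω (2 * x) := by
    rw [moment_eq_lintegral_tail hω hx, moment_eq_lintegral_tail hω (by positivity),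
      ← lintegral_const_mul' _ _ ENNReal.ofReal_ne_top]
    refine setLIntegral_mono' measurableSet_Ioo fun t ht => ?_
    have hsq : t ^ x⁻¹ = (t ^ (2 * x)⁻¹) ^ 2 := by
      rw [← Real.rpow_natCast, ← Real.rpow_mul ht.1.le]
      congr 1
      push_cast; field_simp
    have hu0 : 0 ≤ t ^ (2 * x)⁻¹ := Real.rpow_nonneg ht.1.le _
    have hu1 : t ^ (2 * x)⁻¹ < 1 := Real.rpow_lt_one ht.1.le ht.2 (by positivity)
    rw [hsq]
    set u := t ^ (2 * x)⁻¹
    rw [← ofReal_hat hω (sq_nonneg u), ← ofReal_hat hω hu0, ← ENNReal.ofReal_mul hC.le]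
    refine ENNReal.ofReal_le_ofReal ((h (u ^ 2) ⟨sq_nonneg u, by nlinarith⟩).trans ?_)
    exact mul_le_mul_of_nonneg_left (hat_anti hω hu0 (by nlinarith [sq_nonneg (u - 1)])) hC.le
  have := ENNReal.toReal_mono (ENNReal.mul_ne_top ENNReal.ofReal_ne_top
      (moment_lt_top hω (by positivity)).ne) key
  rwa [ENNReal.toReal_mul, ENNReal.toReal_ofReal hC.le] at this

lemma mom_le_pow_mul {ω : ℝ → ℝ} {C a : ℝ} (hC : 0 < C) (ha : 0 < a)
    (h : ∀ x : ℝ, 0 ≤ x → mom ω x ≤ C * mom ω (a * x)) (k : ℕ) :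
    ∀ x : ℝ, 0 ≤ x → mom ω x ≤ C ^ k * mom ω (a ^ k * x) := by
  induction k with
  | zero => intro x _; simp
  | succ k ih =>
    intro x hx
    calc mom ω x ≤ C ^ k * mom ω (a ^ k * x) := ih x hx
      _ ≤ C ^ k * (C * mom ω (a * (a ^ k * x))) := by
          gcongr
          exact h _ (by positivity)
      _ = _ := by rw [pow_succ, pow_succ, mul_assoc, ← mul_assoc a, mul_comm a]

/-- From log r ≥ 1 - 1/r the exponent log r/(1-r) is at least -1/r ≥ -2. With `momentReal_lower`
this bounds ω̂(r) by e² ω_{1/(1-r)} for r ≥ 1/2. -/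
lemma exp_neg_two_le {r : ℝ} (hr : 1 / 2 ≤ r) (hr1 : r < 1) :
    Real.exp (-2) ≤ r ^ (1 / (1 - r)) := by
  have h0 : 0 < r := by linarith
  have h1 : 0 < 1 - r := by linarith
  rw [Real.rpow_def_of_pos h0, Real.exp_le_exp]
  have h2 := Real.one_sub_inv_le_log_of_pos h0
  have h3 : (1 - r⁻¹) * (1 / (1 - r)) ≤ Real.log r * (1 / (1 - r)) := by gcongr
  refine le_trans ?_ h3
  have h4 : (1 - r⁻¹) * (1 / (1 - r)) = -r⁻¹ := by field_simp; ring
  rw [h4, neg_le_neg_iff]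
  exact inv_le_of_inv_le₀ (by norm_num) (by linarith)

lemma mom_add_le_rpow_mul {ω : ℝ → ℝ} (hω : IsRadialWeight ω) {x y r : ℝ} (hx : 0 ≤ x) (hy : 0 ≤ y)
    (hr : r ∈ Set.Ico (0 : ℝ) 1) : mom ω (x + y) ≤ r ^ y * mom ω x + hat ω r := by
  have key : moment ω (x + y) ≤ ENNReal.ofReal (r ^ y) * moment ω x + tail ω r := by
    have hsplit : Set.Ico (0 : ℝ) 1 = Set.Ico 0 r ∪ Set.Ico r 1 :=
      (Set.Ico_union_Ico_eq_Ico hr.1 hr.2.le).symm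
    unfold moment tail
    rw [← lintegral_const_mul' _ _ ENNReal.ofReal_ne_top]
    conv_lhs => rw [hsplit]
    refine (lintegral_union_le _ _ _).trans (add_le_add ?_ ?_)
    · refine le_trans (setLIntegral_mono_ae' (g := fun s => ENNReal.ofReal (r ^ y) *
        ENNReal.ofReal (s ^ x * ω s)) measurableSet_Ico ?_)
        (lintegral_mono_set (Set.Ico_subset_Ico_right hr.2.le))
      have h0 : ∀ᵐ s : ℝ, s ≠ 0 := by simp [ae_iff]
      filter_upwards [h0] with s hs0 hs
      have hspos : 0 < s := lt_of_le_of_ne hs.1 hs0.symm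
      have h1 := hω.nonneg s ⟨hs.1, hs.2.trans hr.2⟩
      rw [← ENNReal.ofReal_mul (Real.rpow_nonneg hr.1 _)]
      refine ENNReal.ofReal_le_ofReal ?_
      rw [Real.rpow_add hspos, mul_comm (s ^ x), mul_assoc]
      exact mul_le_mul_of_nonneg_right (Real.rpow_le_rpow hs.1 hs.2.le hy)
        (mul_nonneg (Real.rpow_nonneg hs.1 _) h1)
    · refine setLIntegral_mono' measurableSet_Ico fun s hs => ENNReal.ofReal_le_ofReal ?_
      have hs0 := hr.1.trans hs.1
      exact mul_le_of_le_one_left (hω.nonneg s ⟨hs0, hs.2⟩)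
        (Real.rpow_le_one hs0 hs.2.le (add_nonneg hx hy))
  have h2 := ENNReal.toReal_mono (ENNReal.add_ne_top.2 ⟨ENNReal.mul_ne_top ENNReal.ofReal_ne_top
      (moment_lt_top hω hx).ne, (tail_lt_top hω hr.1).ne⟩) key
  rwa [ENNReal.toReal_add (ENNReal.mul_ne_top ENNReal.ofReal_ne_top
      (moment_lt_top hω hx).ne) (tail_lt_top hω hr.1).ne, ENNReal.toReal_mul,
      ENNReal.toReal_ofReal (Real.rpow_nonneg hr.1 _)] at h2

/-- An absorption argument. Iterate doubling k times and split the integral for ω_{2^k x} at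
(1+r)/2. The inner part is at most exp(-(2^k-1)/2) ω_x, so once C^k times this factor is at most 1/2
it moves to the left and only the tail remains. -/
lemma exists_mom_le_hat {ω : ℝ → ℝ} (hω : IsRadialWeight ω) {C : ℝ} (hC : 0 < C)
    (h : ∀ x : ℝ, 0 ≤ x → mom ω x ≤ C * mom ω (2 * x)) :
    ∃ K : ℝ, 0 < K ∧ ∀ r ∈ Set.Ico (0 : ℝ) 1,
      mom ω (1 / (1 - r)) ≤ K * hat ω ((1 + r) / 2) := by
  -- With C < 2^j, the power C^k is at most (2^k)^j, which is polynomial in 2^k and loses to the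
  -- exponential.
  obtain ⟨k, hk⟩ : ∃ k : ℕ, C ^ k * Real.exp (-((2 ^ k - 1) / 2)) ≤ 1 / 2 := by
    obtain ⟨j, hj⟩ := pow_unbounded_of_one_lt C (one_lt_two : (1 : ℝ) < 2)
    have h1 : Tendsto (fun k : ℕ => (2 : ℝ) ^ k / 2) atTop atTop :=
      (tendsto_pow_atTop_atTop_of_one_lt one_lt_two).atTop_div_const two_pos
    have h2 := ((Real.tendsto_pow_mul_exp_neg_atTop_nhds_zero j).comp h1).const_mul
      (2 ^ j * Real.exp (1 / 2))
    rw [mul_zero] at h2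
    obtain ⟨k, hk⟩ := (h2.eventually (ge_mem_nhds (show (0 : ℝ) < 1 / 2 by norm_num))).exists
    refine ⟨k, le_trans ?_ hk⟩
    have h3 : C ^ k ≤ (2 ^ k) ^ j := by
      rw [← pow_mul, mul_comm, pow_mul]
      exact pow_le_pow_left₀ hC.le hj.le k
    simp only [Function.comp_apply]
    have h4 : Real.exp (-((2 ^ k - 1) / 2)) = Real.exp (1 / 2) * Real.exp (-(2 ^ k / 2)) := by
      rw [← Real.exp_add]; congr 1; ring
    rw [h4, div_pow]
    calc C ^ k * (Real.exp (1 / 2) * Real.exp (-(2 ^ k / 2)))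
        ≤ (2 ^ k) ^ j * (Real.exp (1 / 2) * Real.exp (-(2 ^ k / 2))) := by gcongr
      _ = _ := by field_simp
  refine ⟨2 * C ^ k, by positivity, fun r hr => ?_⟩
  have hr1 := hr.1
  have hr2 := hr.2
  have hr3 : 0 < 1 - r := by linarith
  set x := 1 / (1 - r) with hx
  have hx0 : 0 < x := by positivity
  have hk1 : (0 : ℝ) ≤ 2 ^ k - 1 := by
    have : (1 : ℝ) ≤ 2 ^ k := one_le_pow₀ (by norm_num)
    linarith
  have h1 := mom_le_pow_mul hC two_pos h k x hx0.le
  have h2 := mom_add_le_rpow_mul hω (r := (1 + r) / 2) hx0.le (mul_nonneg hk1 hx0.le)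
    ⟨by linarith, by linarith⟩
  rw [show x + (2 ^ k - 1) * x = 2 ^ k * x by ring] at h2
  have h3 : ((1 + r) / 2) ^ ((2 ^ k - 1) * x) ≤ Real.exp (-((2 ^ k - 1) / 2)) := by
    rw [Real.rpow_def_of_pos (by linarith), Real.exp_le_exp]
    have h4 := Real.log_le_sub_one_of_pos (show 0 < (1 + r) / 2 by linarith)
    calc Real.log ((1 + r) / 2) * ((2 ^ k - 1) * x)
        ≤ ((1 + r) / 2 - 1) * ((2 ^ k - 1) * x) :=
          mul_le_mul_of_nonneg_right h4 (mul_nonneg hk1 hx0.le)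
      _ = -((2 ^ k - 1) / 2) := by rw [hx]; field_simp; ring
  have h5 : C ^ k * ((1 + r) / 2) ^ ((2 ^ k - 1) * x) ≤ 1 / 2 :=
    (mul_le_mul_of_nonneg_left h3 (by positivity)).trans hk
  have h6 : mom ω x ≤ C ^ k * (((1 + r) / 2) ^ ((2 ^ k - 1) * x) * mom ω x + hat ω ((1 + r) / 2)) :=
    h1.trans (mul_le_mul_of_nonneg_left h2 (by positivity))
  have h7 : 0 ≤ mom ω x := ENNReal.toReal_nonneg
  nlinarith [mul_le_mul_of_nonneg_right h5 h7]

lemma UpperDoubling.exists_mom_le_mom_two_mul {ω : ℝ → ℝ} (h : UpperDoubling ω) :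
    ∃ C : ℝ, 0 < C ∧ ∀ x : ℝ, 0 ≤ x → mom ω x ≤ C * mom ω (2 * x) := by
  obtain ⟨C, hC, hle⟩ := h.exists_const
  refine ⟨max C 1, lt_max_of_lt_left hC, fun x hx => ?_⟩
  rcases hx.eq_or_lt with rfl | hx
  · rw [mul_zero]
    exact le_mul_of_one_le_left ENNReal.toReal_nonneg (le_max_right _ _)
  · exact (mom_le_mom_two_mul h.1 hC hle hx).trans
      (mul_le_mul_of_nonneg_right (le_max_left _ _) ENNReal.toReal_nonneg)

lemma UpperDoubling.exists_mom_le_hat {ω : ℝ → ℝ} (h : UpperDoubling ω) :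
    ∃ K : ℝ, 0 < K ∧ ∀ r ∈ Set.Ico (0 : ℝ) 1, mom ω (1 / (1 - r)) ≤ K * hat ω r := by
  obtain ⟨C, hC, hle⟩ := h.exists_mom_le_mom_two_mul
  obtain ⟨K, hK, hle⟩ := GrowthBergman.exists_mom_le_hat h.1 hC hle
  exact ⟨K, hK, fun r hr => (hle r hr).trans
    (mul_le_mul_of_nonneg_left (hat_anti h.1 hr.1 (by linarith [hr.2])) hK.le)⟩

/-- The moment at x = 1/(1-r) lies between e⁻² ω̂(r) and K ω̂((1+r)/2). -/
lemma upperDoubling_of_mom_le {ω : ℝ → ℝ} (hω : IsRadialWeight ω) {C : ℝ} (hC : 0 < C)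
    (h : ∀ x : ℝ, 0 ≤ x → mom ω x ≤ C * mom ω (2 * x)) : UpperDoubling ω := by
  obtain ⟨K, hK, hle⟩ := GrowthBergman.exists_mom_le_hat hω hC h
  refine ⟨hω, Real.exp 2 * K, by positivity, ?_⟩
  have h1 : Set.Ioo (1 / 2 : ℝ) 1 ∈ 𝓝[<] (1 : ℝ) := Ioo_mem_nhdsLT (by norm_num)
  filter_upwards [h1] with r hr
  have hr' : r ∈ Set.Ico (0 : ℝ) 1 := ⟨by linarith [hr.1], hr.2⟩
  have h2 := hle r hr'
  have h3 := momentReal_lower (x := 1 / (1 - r)) (by have := hr.2; apply div_nonneg <;> linarith) hr' hω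
  have h4 := mul_le_mul_of_nonneg_right (exp_neg_two_le hr.1.le hr.2) (hat_nonneg ω r)
  have h5 : hat ω r = Real.exp 2 * (Real.exp (-2) * hat ω r) := by
    rw [← mul_assoc, ← Real.exp_add]; simp
  rw [h5, mul_assoc]
  exact mul_le_mul_of_nonneg_left (h4.trans (h3.trans h2)) (Real.exp_pos _).le

/-! ### The weight σ = ω/ν̂ and real forms of the two conditions -/

/-- The quotient `ω / ν̂`. -/
abbrev quot (ω ν : ℝ → ℝ) (s : ℝ) : ℝ := ω s / hat ν s

lemma tail_zero_eq (ω : ℝ → ℝ) : tail ω 0 = moment ω 0 := by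
  simp [tail, moment]

lemma isRadialWeight_quot {ω ν : ℝ → ℝ} (hω : IsRadialWeight ω) (hν : IsRadialWeight ν)
    (h : tail (quot ω ν) 0 < ∞) : IsRadialWeight (quot ω ν) := by
  have hn : ∀ s ∈ Set.Ico (0 : ℝ) 1, 0 ≤ quot ω ν s := fun s hs =>
    div_nonneg (hω.nonneg s hs) (hat_nonneg _ _)
  have hm : AEStronglyMeasurable (quot ω ν) (volume.restrict (Set.Ico 0 1)) :=
    (hω.integrable.aemeasurable.div (measurable_hat ν).aemeasurable).aestronglyMeasurable
  refine ⟨hn, ⟨hm, ?_⟩, fun r hr => ?_⟩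
  · rw [hasFiniteIntegral_iff_ofReal ((ae_restrict_iff' measurableSet_Ico).2 (ae_of_all _ hn))]
    exact h
  · have hp0 := hat_pos hν (r := 0) ⟨le_rfl, one_pos⟩
    have h1 : ENNReal.ofReal (hat ν 0)⁻¹ * tail ω r ≤ tail (quot ω ν) r := by
      unfold tail
      rw [← lintegral_const_mul' _ _ ENNReal.ofReal_ne_top]
      refine setLIntegral_mono' measurableSet_Ico fun s hs => ?_
      have hs0 := hr.1.trans hs.1
      rw [← ENNReal.ofReal_mul (by positivity), mul_comm]
      refine ENNReal.ofReal_le_ofReal ?_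
      exact mul_le_mul_of_nonneg_left (inv_anti₀ (hat_pos hν ⟨hs0, hs.2⟩)
        (hat_anti hν le_rfl hs0)) (hω.nonneg s ⟨hs0, hs.2⟩)
    exact (ENNReal.mul_pos (by simpa using hp0) (hω.tail_pos r hr).ne').trans_le h1

/-- Integrability of σ has to be recorded separately, because `toReal` sends an infinite moment to 0
and would trivialize the real inequality. It follows from the term x = 0 of the supremum. -/
lemma momentCondition_iff {ω ν : ℝ → ℝ} (hω : IsRadialWeight ω) (hν : IsRadialWeight ν) :
    MomentCondition ω ν ↔ IsRadialWeight (quot ω ν) ∧ ∃ K : ℝ, 0 < K ∧ ∀ x : ℝ, 0 ≤ x →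
      mom ν x * mom (quot ω ν) x ≤ K * mom ω (2 * x) := by
  have heq : ∀ x : ℝ, 0 ≤ x → moment ν x / moment ω (2 * x) =
      ENNReal.ofReal (mom ν x / mom ω (2 * x)) := fun x hx => by
    rw [ENNReal.ofReal_div_of_pos (momentReal_pos hω (by positivity)), ofReal_mom hν hx,
      ofReal_mom hω (by positivity)]
  unfold MomentCondition
  constructor
  · intro h
    set S := ⨆ x : ℝ, ⨆ _ : 0 ≤ x,
      moment ν x / moment ω (2 * x) * moment (quot ω ν) x with hS
    have hle : ∀ x : ℝ, 0 ≤ x →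
        ENNReal.ofReal (mom ν x / mom ω (2 * x)) * moment (quot ω ν) x ≤ S := fun x hx => by
      rw [← heq x hx]
      exact le_iSup₂ (f := fun (x : ℝ) (_ : 0 ≤ x) =>
        moment ν x / moment ω (2 * x) * moment (quot ω ν) x) x hx
    have hσ : IsRadialWeight (quot ω ν) := by
      refine isRadialWeight_quot hω hν ?_
      rw [tail_zero_eq]
      have h0 := (hle 0 le_rfl).trans_lt h
      refine ENNReal.lt_top_of_mul_ne_top_right h0.ne ?_
      have h1 := momentReal_pos hν (x := 0) le_rfl
      have h2 := momentReal_pos hω (x := 2 * 0) (by simp)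
      simpa using div_pos h1 h2
    refine ⟨hσ, S.toReal + 1, by positivity, fun x hx => ?_⟩
    have h1 := ENNReal.toReal_mono h.ne (hle x hx)
    have h2 := momentReal_pos hω (x := 2 * x) (by positivity)
    rw [ENNReal.toReal_mul, ENNReal.toReal_ofReal (by positivity), div_mul_eq_mul_div,
      div_le_iff₀ h2] at h1
    linarith
  · rintro ⟨hσ, K, hK, hle⟩
    refine lt_of_le_of_lt (iSup₂_le fun x hx => ?_) (ENNReal.ofReal_lt_top (r := K))
    change _ * moment (quot ω ν) x ≤ _
    have h2 := momentReal_pos hω (x := 2 * x) (by positivity)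
    rw [heq x hx, ← ofReal_mom hσ hx, ← ENNReal.ofReal_mul (by positivity)]
    refine ENNReal.ofReal_le_ofReal ?_
    rw [div_mul_eq_mul_div, div_le_iff₀ h2]
    exact hle x hx

lemma tailCondition_iff {ω ν : ℝ → ℝ} (hω : IsRadialWeight ω) (hν : IsRadialWeight ν) :
    TailCondition ω ν ↔ IsRadialWeight (quot ω ν) ∧ ∃ K : ℝ, 0 < K ∧ ∀ r ∈ Set.Ico (0 : ℝ) 1,
      hat ν r * hat (quot ω ν) r ≤ K * hat ω r := by
  have heq : ∀ r ∈ Set.Ico (0 : ℝ) 1, tail ν r / tail ω r =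
      ENNReal.ofReal (hat ν r / hat ω r) := fun r hr => by
    rw [ENNReal.ofReal_div_of_pos (hat_pos hω hr), ofReal_hat hν hr.1, ofReal_hat hω hr.1]
  unfold TailCondition
  constructor
  · intro h
    set S := ⨆ r ∈ Set.Ico (0 : ℝ) 1, tail ν r / tail ω r * tail (quot ω ν) r with hS
    have hle : ∀ r ∈ Set.Ico (0 : ℝ) 1,
        ENNReal.ofReal (hat ν r / hat ω r) * tail (quot ω ν) r ≤ S := fun x hx => by
      rw [← heq x hx]
      exact le_iSup₂ (f := fun (r : ℝ) (_ : r ∈ Set.Ico (0 : ℝ) 1) =>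
        tail ν r / tail ω r * tail (quot ω ν) r) x hx
    have hσ : IsRadialWeight (quot ω ν) := by
      refine isRadialWeight_quot hω hν ?_
      have h0 := (hle 0 ⟨le_rfl, one_pos⟩).trans_lt h
      refine ENNReal.lt_top_of_mul_ne_top_right h0.ne ?_
      have h1 := hat_pos hν (r := 0) ⟨le_rfl, one_pos⟩
      have h2 := hat_pos hω (r := 0) ⟨le_rfl, one_pos⟩
      simpa using div_pos h1 h2
    refine ⟨hσ, S.toReal + 1, by positivity, fun x hx => ?_⟩
    have h1 := ENNReal.toReal_mono h.ne (hle x hx)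
    have h2 := hat_pos hω hx
    have h3 := hat_pos hν hx
    rw [ENNReal.toReal_mul, ENNReal.toReal_ofReal (by positivity), div_mul_eq_mul_div,
      div_le_iff₀ h2] at h1
    have h4 : hat ν x * hat (quot ω ν) x ≤ S.toReal * hat ω x := h1
    linarith
  · rintro ⟨hσ, K, hK, hle⟩
    refine lt_of_le_of_lt (iSup₂_le fun x hx => ?_) (ENNReal.ofReal_lt_top (r := K))
    change _ * tail (quot ω ν) x ≤ _
    have h2 := hat_pos hω hx
    have h3 := hat_pos hν hx
    rw [heq x hx, ← ofReal_hat hσ hx.1, ← ENNReal.ofReal_mul (by positivity)]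
    refine ENNReal.ofReal_le_ofReal ?_
    rw [div_mul_eq_mul_div, div_le_iff₀ h2]
    exact hle x hx

/-! ### From the moment condition to doubling of ω and the tail condition -/

lemma mom_add_le_mul_mom_quot {ω ν : ℝ → ℝ} (hν : IsRadialWeight ν)
    (hσ : IsRadialWeight (quot ω ν)) {x y : ℝ} (hx : 0 ≤ x) (hy : 0 ≤ y) :
    mom ω (x + y) ≤ mom ν y * mom (quot ω ν) x := by
  have key : moment ω (x + y) ≤ moment ν y * moment (quot ω ν) x := by
    rw [← ofReal_mom hν hy]
    unfold moment
    rw [← lintegral_const_mul' _ _ ENNReal.ofReal_ne_top]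
    refine setLIntegral_mono_ae' measurableSet_Ico ?_
    have h0 : ∀ᵐ s : ℝ, s ≠ 0 := by simp [ae_iff]
    filter_upwards [h0] with s hs0 hs
    have hspos : 0 < s := lt_of_le_of_ne hs.1 hs0.symm
    have hp := hat_pos hν hs
    rw [← ENNReal.ofReal_mul ENNReal.toReal_nonneg]
    refine ENNReal.ofReal_le_ofReal ?_
    have h1 := momentReal_lower hy hs hν
    have h2 : 0 ≤ s ^ x * quot ω ν s := mul_nonneg (Real.rpow_nonneg hs.1 _) (hσ.nonneg s hs)
    -- Write ω = ν̂ σ and bound s^y ν̂(s) ≤ ν_y pointwise.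
    calc s ^ (x + y) * ω s = (s ^ y * hat ν s) * (s ^ x * quot ω ν s) := by
          rw [Real.rpow_add hspos]; simp only [quot]; field_simp
      _ ≤ _ := mul_le_mul_of_nonneg_right h1 h2
  have := ENNReal.toReal_mono (ENNReal.mul_ne_top (moment_lt_top hν hy).ne
    (moment_lt_top hσ hx).ne) key
  rwa [ENNReal.toReal_mul] at this

/-- Splitting x = 2x/3 + x/3 gives ω_x ≤ ν_{x/3} σ_{2x/3}. Doubling of ν raises its index to 2x/3,
where the hypothesis applies and returns ω_{4x/3}. The uneven split is what makes the final index
exceed x. -/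
lemma MomentCondition.upperDoubling {ω ν : ℝ → ℝ} (hω : IsRadialWeight ω) (hν : UpperDoubling ν)
    (h : MomentCondition ω ν) : UpperDoubling ω := by
  obtain ⟨hσ, K, hK, hle⟩ := (momentCondition_iff hω hν.1).1 h
  obtain ⟨C, hC, hdb⟩ := hν.exists_mom_le_mom_two_mul
  have h1 : ∀ x : ℝ, 0 ≤ x → mom ω x ≤ (C * K) * mom ω (4 / 3 * x) := fun x hx => by
    have h2 := mom_add_le_mul_mom_quot hν.1 hσ (x := 2 * x / 3) (y := x / 3)
      (by positivity) (by positivity)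
    have h3 := hdb (x / 3) (by positivity)
    have h4 := hle (2 * x / 3) (by positivity)
    rw [show 2 * x / 3 + x / 3 = x by ring] at h2
    rw [show 2 * (x / 3) = 2 * x / 3 by ring] at h3
    rw [show 2 * (2 * x / 3) = 4 / 3 * x by ring] at h4
    calc mom ω x ≤ mom ν (x / 3) * mom (quot ω ν) (2 * x / 3) := h2
      _ ≤ C * mom ν (2 * x / 3) * mom (quot ω ν) (2 * x / 3) := by gcongr
      _ = C * (mom ν (2 * x / 3) * mom (quot ω ν) (2 * x / 3)) := by ring
      _ ≤ C * (K * mom ω (4 / 3 * x)) := by gcongr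
      _ = _ := by ring
  -- Three iterations are enough, since (4/3)³ = 64/27 ≥ 2.
  refine upperDoubling_of_mom_le hω (C := (C * K) ^ 3) (by positivity) fun x hx => ?_
  refine (mom_le_pow_mul (by positivity) (by norm_num) h1 3 x hx).trans ?_
  refine mul_le_mul_of_nonneg_left (mom_anti hω (by positivity) ?_) (by positivity)
  nlinarith

/-- At x = 1/(1-r) with r > 1/2 the tails of ν and σ are at most e² times their moments, while
ω_{2x} ≤ ω_x ≤ C ω̂(r) by the doubling of ω already obtained. For r ≤ 1/2 monotonicity suffices. -/
lemma MomentCondition.tailCondition {ω ν : ℝ → ℝ} (hω : IsRadialWeight ω) (hν : UpperDoubling ν)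
    (h : MomentCondition ω ν) : TailCondition ω ν := by
  obtain ⟨C, hC, hdb⟩ := (h.upperDoubling hω hν).exists_mom_le_hat
  obtain ⟨hσ, K, hK, hle⟩ := (momentCondition_iff hω hν.1).1 h
  have h0 : (0 : ℝ) ∈ Set.Ico (0 : ℝ) 1 := ⟨le_rfl, one_pos⟩
  have hh : (1 / 2 : ℝ) ∈ Set.Ico (0 : ℝ) 1 := by constructor <;> norm_num
  have hph := hat_pos hω hh
  set A := hat ν 0 * hat (quot ω ν) 0 / hat ω (1 / 2)
  set B := Real.exp 2 * Real.exp 2 * (K * C)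
  have hB : 0 < B := by positivity
  have hA : 0 < A := div_pos (mul_pos (hat_pos hν.1 h0) (hat_pos hσ h0)) hph
  refine (tailCondition_iff hω hν.1).2 ⟨hσ, A + B, by positivity, fun r hr => ?_⟩
  have hr1 := hr.1
  have hr2 := hr.2
  have hp := hat_pos hω hr
  rcases le_or_gt r (1 / 2) with h2 | h2
  · calc hat ν r * hat (quot ω ν) r ≤ hat ν 0 * hat (quot ω ν) 0 :=
          mul_le_mul (hat_anti hν.1 le_rfl hr1) (hat_anti hσ le_rfl hr1) (hat_nonneg _ _)
            (hat_nonneg _ _)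
      _ = A * hat ω (1 / 2) := by simp only [A]; field_simp
      _ ≤ (A + B) * hat ω r := mul_le_mul (by linarith) (hat_anti hω hr1 h2) hph.le (by positivity)
  · have hx : 0 ≤ 1 / (1 - r) := by apply div_nonneg <;> linarith
    have hE := exp_neg_two_le h2.le hr2
    have hEi : Real.exp 2 * Real.exp (-2) = 1 := by rw [← Real.exp_add]; simp
    have hn : ∀ μ : ℝ → ℝ, IsRadialWeight μ → hat μ r ≤ Real.exp 2 * mom μ (1 / (1 - r)) := by
      intro μ hμ
      calc hat μ r = Real.exp 2 * (Real.exp (-2) * hat μ r) := by rw [← mul_assoc, hEi, one_mul]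
        _ ≤ _ := by
          refine mul_le_mul_of_nonneg_left ?_ (Real.exp_pos _).le
          exact (mul_le_mul_of_nonneg_right hE (hat_nonneg _ _)).trans (momentReal_lower hx hr hμ)
    calc hat ν r * hat (quot ω ν) r
        ≤ (Real.exp 2 * mom ν (1 / (1 - r))) * (Real.exp 2 * mom (quot ω ν) (1 / (1 - r))) :=
          mul_le_mul (hn _ hν.1) (hn _ hσ) (hat_nonneg _ _) (by positivity)
      _ = Real.exp 2 * Real.exp 2 * (mom ν (1 / (1 - r)) * mom (quot ω ν) (1 / (1 - r))) := by ring
      _ ≤ Real.exp 2 * Real.exp 2 * (K * (C * hat ω r)) := by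
          refine mul_le_mul_of_nonneg_left ((hle _ hx).trans ?_) (by positivity)
          refine mul_le_mul_of_nonneg_left (le_trans ?_ (hdb r hr)) hK.le
          exact mom_anti hω hx (by linarith)
      _ = B * hat ω r := by simp only [B]; ring
      _ ≤ _ := mul_le_mul_of_nonneg_right (by linarith) hp.le

/-! ### Fourier coefficients and Parseval on the unit circle -/

lemma integral_circleMap_pow_mul_conj (j n : ℕ) :
    ∫ θ in Set.Ioo (-Real.pi) Real.pi, circleMap 0 1 θ ^ j * conj (circleMap 0 1 θ) ^ n =
      if j = n then (2 * Real.pi : ℂ) else 0 := by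
  rw [← integral_Ioc_eq_integral_Ioo, ← intervalIntegral.integral_of_le (by linarith [Real.pi_pos])]
  have h : ∀ θ : ℝ, circleMap 0 1 θ ^ j * conj (circleMap 0 1 θ) ^ n =
      Complex.exp ((((j : ℤ) - n : ℤ) * Complex.I) * θ) := by
    intro θ
    simp only [circleMap, Complex.ofReal_one, one_mul, zero_add, ← Complex.exp_conj, map_mul,
      Complex.conj_ofReal, Complex.conj_I]
    rw [← Complex.exp_nat_mul, ← Complex.exp_nat_mul, ← Complex.exp_add]
    congr 1; push_cast; ring
  simp_rw [h]
  split_ifs with hjn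
  · subst hjn
    simp; ring_nf
  · have hne : (((j : ℤ) - n : ℤ) : ℂ) ≠ 0 := by
      rw [Int.cast_ne_zero]; omega
    rw [integral_exp_mul_complex (mul_ne_zero hne Complex.I_ne_zero)]
    have : Complex.exp ((((j : ℤ) - n : ℤ) * Complex.I) * (Real.pi : ℝ)) =
        Complex.exp ((((j : ℤ) - n : ℤ) * Complex.I) * ((-Real.pi : ℝ) : ℂ)) := by
      rw [Complex.exp_eq_exp_iff_exists_int]
      exact ⟨(j : ℤ) - n, by push_cast; ring⟩
    rw [this, sub_self, zero_div]

lemma norm_circleMap_one (θ : ℝ) : ‖circleMap 0 1 θ‖ = 1 := by simp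

lemma continuous_tsum_circleMap {d : ℕ → ℂ} (hd : Summable fun n => ‖d n‖) :
    Continuous fun θ : ℝ => ∑' n, d n * conj (circleMap 0 1 θ) ^ n := by
  refine continuous_tsum (fun n => ?_) hd fun n θ => by simp
  have := continuous_circleMap 0 1
  fun_prop

lemma integrableOn_Ioo_of_continuous {E : Type*} [NormedAddCommGroup E] {f : ℝ → E}
    (hf : Continuous f) (a b : ℝ) : IntegrableOn f (Set.Ioo a b) :=
  hf.integrableOn_Icc.mono_set Set.Ioo_subset_Icc_self

lemma volume_real_Ioo_pi : volume.real (Set.Ioo (-Real.pi) Real.pi) = 2 * Real.pi := by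
  rw [Measure.real, Real.volume_Ioo, ENNReal.toReal_ofReal (by linarith [Real.pi_pos])]
  ring

lemma integral_fourier_coeff {d : ℕ → ℂ} (hd : Summable fun n => ‖d n‖) (j : ℕ) :
    ∫ θ in Set.Ioo (-Real.pi) Real.pi,
      circleMap 0 1 θ ^ j * ∑' n, d n * conj (circleMap 0 1 θ) ^ n = 2 * Real.pi * d j := by
  have hc := continuous_circleMap 0 1
  have hs := hasSum_integral_of_summable_integral_norm
    (μ := volume.restrict (Set.Ioo (-Real.pi) Real.pi))
    (F := fun n θ => d n * (circleMap 0 1 θ ^ j * conj (circleMap 0 1 θ) ^ n))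
    (fun n => integrableOn_Ioo_of_continuous (by fun_prop) _ _)
    (by
      refine (hd.mul_right (2 * Real.pi)).congr fun n => ?_
      simp [Real.pi_pos.le]
      ring)
  have h1 : (∫ θ in Set.Ioo (-Real.pi) Real.pi,
      circleMap 0 1 θ ^ j * ∑' n, d n * conj (circleMap 0 1 θ) ^ n) =
      ∫ θ in Set.Ioo (-Real.pi) Real.pi,
        ∑' n, d n * (circleMap 0 1 θ ^ j * conj (circleMap 0 1 θ) ^ n) := by
    refine integral_congr_ae (ae_of_all _ fun θ => ?_)
    simp only
    rw [← tsum_mul_left]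
    exact tsum_congr fun n => by ring
  rw [h1, ← hs.tsum_eq, tsum_eq_single j]
  · rw [integral_const_mul, integral_circleMap_pow_mul_conj, if_pos rfl]; ring
  · intro n hn
    rw [integral_const_mul, integral_circleMap_pow_mul_conj, if_neg hn.symm, mul_zero]

/-- Parseval: expand only the conjugate factor of |h|² and integrate term by term, each term being a
Fourier coefficient of h. Absolute summability of d justifies the exchange. -/
lemma integral_norm_sq_tsum {d : ℕ → ℂ} (hd : Summable fun n => ‖d n‖) :
    ∫ θ in Set.Ioo (-Real.pi) Real.pi, ‖∑' n, d n * conj (circleMap 0 1 θ) ^ n‖ ^ 2 =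
      2 * Real.pi * ∑' n, ‖d n‖ ^ 2 := by
  have hc := continuous_circleMap 0 1
  set h : ℝ → ℂ := fun θ => ∑' n, d n * conj (circleMap 0 1 θ) ^ n with hh
  have hcont : Continuous h := continuous_tsum_circleMap hd
  have hbd : ∀ θ, ‖h θ‖ ≤ ∑' n, ‖d n‖ := fun θ =>
    tsum_of_norm_bounded hd.hasSum fun n => by simp
  have hs := hasSum_integral_of_summable_integral_norm
    (μ := volume.restrict (Set.Ioo (-Real.pi) Real.pi))
    (F := fun n θ => conj (d n) * (circleMap 0 1 θ ^ n * h θ))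
    (fun n => integrableOn_Ioo_of_continuous (by fun_prop) _ _)
    (by
      refine Summable.of_nonneg_of_le (fun n => integral_nonneg fun θ => norm_nonneg _)
        (fun n => ?_) (hd.mul_right ((∑' n, ‖d n‖) * (2 * Real.pi)))
      have h1 := norm_setIntegral_le_of_norm_le_const (μ := volume)
        (s := Set.Ioo (-Real.pi) Real.pi) (C := ‖d n‖ * ∑' n, ‖d n‖)
        (f := fun θ => ‖conj (d n) * (circleMap 0 1 θ ^ n * h θ)‖) (by simp)
        (fun θ _ => by
          simp only [norm_norm, norm_mul, norm_pow, norm_circleMap_one, one_pow, one_mul,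
            RCLike.norm_conj]
          gcongr
          exact hbd θ)
      rw [volume_real_Ioo_pi] at h1
      rw [← mul_assoc]
      exact (le_abs_self _).trans h1)
  have h1 : (∫ θ in Set.Ioo (-Real.pi) Real.pi,
        ∑' n, conj (d n) * (circleMap 0 1 θ ^ n * h θ)) =
      ((∫ θ in Set.Ioo (-Real.pi) Real.pi, ‖h θ‖ ^ 2 : ℝ) : ℂ) := by
    rw [← integral_complex_ofReal]
    refine integral_congr_ae (ae_of_all _ fun θ => ?_)
    simp only
    push_cast
    rw [← Complex.conj_mul', hh, Complex.conj_tsum, ← tsum_mul_right]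
    refine tsum_congr fun n => ?_
    simp only [map_mul, map_pow, Complex.conj_conj]
    ring
  have h2 : ∀ n, ∫ θ in Set.Ioo (-Real.pi) Real.pi, conj (d n) * (circleMap 0 1 θ ^ n * h θ) =
      ((2 * Real.pi * ‖d n‖ ^ 2 : ℝ) : ℂ) := by
    intro n
    rw [integral_const_mul, integral_fourier_coeff hd]
    push_cast
    rw [← Complex.conj_mul']; ring
  rw [h1, funext h2] at hs
  have h3 := Complex.hasSum_ofReal.1 hs
  rw [← tsum_mul_left]
  exact h3.tsum_eq.symm

/-! ### The derivative of the Bergman kernel and the coefficients of (1-u)k'(u) -/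

/-- The generating function `∑ uⁿ / (2 ω_{2n+1})` of the Bergman kernel. -/
def kern (ω : ℝ → ℝ) (u : ℂ) : ℂ := ∑' n : ℕ, u ^ n / ((2 * mom ω (2 * n + 1) : ℝ) : ℂ)

lemma conj_bergmanKernel (ω : ℝ → ℝ) (z ζ : ℂ) :
    conj (bergmanKernel ω z ζ) = kern ω (z * conj ζ) := by
  simp only [bergmanKernel, kern, Complex.conj_tsum]
  refine tsum_congr fun n => ?_
  simp only [map_div₀, map_pow, map_mul, Complex.conj_conj, Complex.conj_ofReal]

/-- The coefficients `1 / (2 ω_{2n+1})` of the Bergman kernel. -/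
def kcoef (ω : ℝ → ℝ) (n : ℕ) : ℝ := 1 / (2 * mom ω (2 * n + 1))

lemma kern_eq (ω : ℝ → ℝ) (u : ℂ) : kern ω u = ∑' n : ℕ, (kcoef ω n : ℂ) * u ^ n := by
  unfold kern kcoef
  refine tsum_congr fun n => ?_
  push_cast; ring

lemma kcoef_pos {ω : ℝ → ℝ} (hω : IsRadialWeight ω) (n : ℕ) : 0 < kcoef ω n := by
  have := momentReal_pos hω (x := 2 * n + 1) (by positivity)
  unfold kcoef; positivity

lemma summable_kcoef {ω : ℝ → ℝ} (hω : IsRadialWeight ω) {t : ℝ} (ht0 : 0 ≤ t) (ht : t < 1) :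
    Summable fun n : ℕ => kcoef ω n * t ^ n :=
  (summable_coeff hω ht0 ht).congr fun n => by unfold kcoef; ring

lemma exists_ball_of_mem_disc {u : ℂ} (hu : u ∈ disc) :
    ∃ R : ℝ, 0 ≤ R ∧ R < 1 ∧ u ∈ Metric.ball (0 : ℂ) R := by
  have h := disc_norm.1 hu
  exact ⟨(1 + ‖u‖) / 2, by positivity, by linarith, by simp; linarith⟩

lemma norm_kcoef_mul_le {ω : ℝ → ℝ} (hω : IsRadialWeight ω) (n : ℕ) {R : ℝ} {u : ℂ}
    (hu : u ∈ Metric.ball (0 : ℂ) R) : ‖(kcoef ω n : ℂ) * u ^ n‖ ≤ kcoef ω n * R ^ n := by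
  rw [norm_mul, norm_pow, Complex.norm_real, Real.norm_of_nonneg (kcoef_pos hω n).le]
  have := (kcoef_pos hω n).le
  rw [mem_ball_zero_iff] at hu
  gcongr

lemma differentiableOn_kern {ω : ℝ → ℝ} (hω : IsRadialWeight ω) :
    DifferentiableOn ℂ (kern ω) disc := by
  intro u hu
  obtain ⟨R, hR0, hR1, hR⟩ := exists_ball_of_mem_disc hu
  rw [funext (kern_eq ω)]
  have h := Complex.differentiableOn_tsum_of_summable_norm (F := fun n u => (kcoef ω n : ℂ) * u ^ n)
    (summable_kcoef hω hR0 hR1) (fun n => by fun_prop) Metric.isOpen_ball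
    (fun n w hw => norm_kcoef_mul_le hω n hw)
  exact ((h u hR).differentiableAt (Metric.isOpen_ball.mem_nhds hR)).differentiableWithinAt

lemma hasSum_deriv_kern {ω : ℝ → ℝ} (hω : IsRadialWeight ω) {u : ℂ} (hu : u ∈ disc) :
    HasSum (fun n : ℕ => (kcoef ω (n + 1) : ℂ) * (n + 1) * u ^ n) (deriv (kern ω) u) := by
  obtain ⟨R, hR0, hR1, hR⟩ := exists_ball_of_mem_disc hu
  have h := Complex.hasSum_deriv_of_summable_norm (F := fun n u => (kcoef ω n : ℂ) * u ^ n)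
    (summable_kcoef hω hR0 hR1) (fun n => by fun_prop) Metric.isOpen_ball
    (fun n w hw => norm_kcoef_mul_le hω n hw) hR
  rw [← funext (kern_eq ω)] at h
  have h2 := (hasSum_nat_add_iff' (f := fun n : ℕ => deriv (fun u : ℂ => (kcoef ω n : ℂ) * u ^ n) u)
    1).2 h
  simp only [Finset.range_one, Finset.sum_singleton, pow_zero, deriv_const, sub_zero] at h2
  refine h2.congr_fun fun n => ?_
  simp [mul_assoc]

lemma continuousOn_deriv_kern {ω : ℝ → ℝ} (hω : IsRadialWeight ω) :
    ContinuousOn (deriv (kern ω)) disc :=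
  ((differentiableOn_kern hω).deriv Metric.isOpen_ball).continuousOn

/-- The Taylor coefficients of `(1 - u) k'(u)`, where `k` generates the Bergman kernel. -/
def dcoef (ω : ℝ → ℝ) (n : ℕ) : ℝ := (n + 1) * kcoef ω (n + 1) - n * kcoef ω n

lemma hasSum_one_sub_mul_deriv_kern {ω : ℝ → ℝ} (hω : IsRadialWeight ω) {u : ℂ} (hu : u ∈ disc) :
    HasSum (fun n : ℕ => (dcoef ω n : ℂ) * u ^ n) ((1 - u) * deriv (kern ω) u) := by
  have h1 := hasSum_deriv_kern hω hu
  have h2 : HasSum (fun n : ℕ => (kcoef ω n : ℂ) * n * u ^ n) (u * deriv (kern ω) u) := by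
    refine (hasSum_nat_add_iff' 1).1 ?_
    simp only [Finset.range_one, Finset.sum_singleton, Nat.cast_zero, mul_zero, zero_mul, sub_zero]
    refine (h1.mul_left u).congr_fun fun n => ?_
    push_cast; ring
  rw [sub_mul, one_mul]
  refine (h1.sub h2).congr_fun fun n => ?_
  unfold dcoef; push_cast; ring

/-- The left side consists of two terms of the binomial expansion of (s + (1-s))^(n+1) = 1. Only the
first is used later; the second makes the induction close. -/
lemma pow_mul_one_sub_le (n : ℕ) {s : ℝ} (hs0 : 0 ≤ s) (hs1 : s ≤ 1) :
    (n + 1) * s ^ n * (1 - s) + s ^ (n + 1) ≤ 1 := by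
  induction n with
  | zero => simp
  | succ n ih =>
    have h1 : s ^ (n + 1) ≤ 1 := pow_le_one₀ hs0 hs1
    push_cast
    calc ((n : ℝ) + 1 + 1) * s ^ (n + 1) * (1 - s) + s ^ (n + 1 + 1)
        = s * ((n + 1) * s ^ n * (1 - s) + s ^ (n + 1)) + s ^ (n + 1) * (1 - s) := by ring
      _ ≤ s * 1 + 1 * (1 - s) := by gcongr
      _ = 1 := by ring

/-- The difference s^(2n+1) - s^(2n+3) equals s^(n+1) · sⁿ(1-s)(1+s), and sⁿ(1-s) ≤ 1/(n+1). Half of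
the power is spent on gaining 1/(n+1). -/
lemma mom_le_mom_add {ω : ℝ → ℝ} (hω : IsRadialWeight ω) (n : ℕ) :
    mom ω (2 * n + 1) ≤ mom ω (2 * n + 3) + 2 / (n + 1) * mom ω (n + 1) := by
  have hc : (0 : ℝ) ≤ 2 / (n + 1) := by positivity
  have key : moment ω (2 * n + 1) ≤
      moment ω (2 * n + 3) + ENNReal.ofReal (2 / (n + 1)) * moment ω (n + 1) := by
    unfold moment
    rw [← lintegral_const_mul' _ _ ENNReal.ofReal_ne_top, ← lintegral_add_left']
    · refine setLIntegral_mono' measurableSet_Ico fun s hs => ?_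
      have h0 := hω.nonneg s hs
      have hs1 := hs.1
      have hs2 := hs.2
      rw [← ENNReal.ofReal_mul hc, ← ENNReal.ofReal_add (mul_nonneg (Real.rpow_nonneg hs1 _) h0)
        (mul_nonneg hc (mul_nonneg (Real.rpow_nonneg hs1 _) h0))]
      refine ENNReal.ofReal_le_ofReal ?_
      have e1 : s ^ (2 * (n : ℝ) + 1) = s ^ (2 * n + 1) := by rw [← Real.rpow_natCast]; norm_num
      have e2 : s ^ (2 * (n : ℝ) + 3) = s ^ (2 * n + 3) := by rw [← Real.rpow_natCast]; norm_num
      have e3 : s ^ ((n : ℝ) + 1) = s ^ (n + 1) := by rw [← Real.rpow_natCast]; norm_num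
      rw [e1, e2, e3, ← mul_assoc, ← add_mul]
      refine mul_le_mul_of_nonneg_right ?_ h0
      have h1 := pow_mul_one_sub_le n hs1 hs2.le
      have h2 : s ^ n * (1 - s) ≤ 1 / (n + 1) := by
        rw [le_div_iff₀ (by positivity)]
        nlinarith [pow_nonneg hs1 (n + 1)]
      have h3 : s ^ n * (1 - s) * (1 + s) ≤ 1 / (n + 1) * 2 := by
        gcongr
        linarith
      have h4 : s ^ (2 * n + 1) - s ^ (2 * n + 3) = s ^ (n + 1) * (s ^ n * (1 - s) * (1 + s)) := by
        ring
      have h5 := mul_le_mul_of_nonneg_left h3 (pow_nonneg hs1 (n + 1))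
      rw [← h4] at h5
      have h6 : s ^ (n + 1) * (1 / (n + 1) * 2) = 2 / (n + 1) * s ^ (n + 1) := by ring
      linarith
    · exact ((Measurable.aemeasurable (by fun_prop)).mul hω.integrable.aemeasurable).ennreal_ofReal
  have hf := moment_lt_top hω (x := 2 * n + 3) (by positivity)
  have hf2 := ENNReal.mul_ne_top (a := ENNReal.ofReal (2 / ((n : ℝ) + 1))) ENNReal.ofReal_ne_top
    (moment_lt_top hω (x := n + 1) (by positivity)).ne
  have h2 := ENNReal.toReal_mono (ENNReal.add_ne_top.2 ⟨hf.ne, hf2⟩) key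
  rwa [ENNReal.toReal_add hf.ne hf2, ENNReal.toReal_mul, ENNReal.toReal_ofReal hc] at h2

/-- With P = ω_{2n+1} and Q = ω_{2n+3}, the coefficient equals (1 + n(P-Q)/P)/(2Q). The preceding
difference estimate and doubling give n(P-Q) ≤ 2C P, so the factor n is lost; three unit shifts
compare Q with ω_{2n}. -/
lemma exists_dcoef_le {ω : ℝ → ℝ} (h : UpperDoubling ω) :
    ∃ K : ℝ, 0 < K ∧ ∀ n : ℕ, 0 ≤ dcoef ω n ∧ dcoef ω n ≤ K / mom ω (2 * n) := by
  obtain ⟨C, hC, hdb⟩ := h.exists_mom_le_mom_two_mul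
  obtain ⟨S, hS1, hS⟩ := exists_mom_le_mom_add_one h.1
  have hS0 : 0 < S := by linarith
  refine ⟨(1 + 2 * C) / 2 * S ^ 3, by positivity, fun n => ?_⟩
  have hω := h.1
  have hP : 0 < mom ω (2 * n + 1) := momentReal_pos hω (x := 2 * n + 1) (by positivity)
  have hQ : 0 < mom ω (2 * n + 3) := momentReal_pos hω (x := 2 * n + 3) (by positivity)
  have hR : 0 < mom ω (2 * n) := momentReal_pos hω (x := 2 * n) (by positivity)
  have hPQ : mom ω (2 * n + 3) ≤ mom ω (2 * n + 1) := mom_anti hω (by positivity) (by linarith)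
  have hsub := mom_le_mom_add hω n
  have h1 : mom ω (n + 1) ≤ C * mom ω (2 * n + 1) :=
    (hdb (n + 1) (by positivity)).trans (mul_le_mul_of_nonneg_left
      (mom_anti hω (by positivity) (by linarith)) hC.le)
  have hRQ : mom ω (2 * n) ≤ S ^ 3 * mom ω (2 * n + 3) := by
    have a1 := hS (2 * n) (by positivity)
    have a2 := hS (2 * n + 1) (by positivity)
    have a3 := hS (2 * n + 1 + 1) (by positivity)
    rw [show (2 * (n : ℝ) + 1 + 1 + 1) = 2 * n + 3 by ring] at a3
    calc mom ω (2 * n) ≤ S * (S * (S * mom ω (2 * n + 3))) := by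
          refine a1.trans ?_
          gcongr
          refine a2.trans ?_
          gcongr
      _ = _ := by ring
  have hd : dcoef ω n = (1 + n * ((mom ω (2 * n + 1) - mom ω (2 * n + 3)) / mom ω (2 * n + 1))) /
      (2 * mom ω (2 * n + 3)) := by
    have e : kcoef ω (n + 1) = 1 / (2 * mom ω (2 * n + 3)) := by
      unfold kcoef; push_cast; ring_nf
    unfold dcoef
    rw [e]
    unfold kcoef
    generalize mom ω (2 * n + 1) = P at hP
    generalize mom ω (2 * n + 3) = Q at hQ
    field_simp
    ring
  have hn : n * ((mom ω (2 * n + 1) - mom ω (2 * n + 3)) / mom ω (2 * n + 1)) ≤ 2 * C := by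
    rw [← mul_div_assoc, div_le_iff₀ hP]
    have h2 : (n : ℝ) * (2 / (n + 1)) ≤ 2 := by
      rw [← mul_div_assoc, div_le_iff₀ (by positivity)]; linarith
    calc n * (mom ω (2 * n + 1) - mom ω (2 * n + 3))
        ≤ n * (2 / (n + 1) * (C * mom ω (2 * n + 1))) := by
          gcongr
          have : 2 / ((n : ℝ) + 1) * mom ω (n + 1) ≤ 2 / (n + 1) * (C * mom ω (2 * n + 1)) := by
            gcongr
          linarith
      _ = (n * (2 / (n + 1))) * (C * mom ω (2 * n + 1)) := by ring
      _ ≤ 2 * (C * mom ω (2 * n + 1)) := by gcongr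
      _ = _ := by ring
  rw [hd]
  constructor
  · have : 0 ≤ (mom ω (2 * n + 1) - mom ω (2 * n + 3)) / mom ω (2 * n + 1) :=
      div_nonneg (by linarith) hP.le
    positivity
  · rw [div_le_div_iff₀ (by positivity) hR]
    calc (1 + n * ((mom ω (2 * n + 1) - mom ω (2 * n + 3)) / mom ω (2 * n + 1))) * mom ω (2 * n)
        ≤ (1 + 2 * C) * (S ^ 3 * mom ω (2 * n + 3)) := by gcongr
      _ = _ := by ring

/-- Two doublings move ρ to r = (3+ρ)/4, and Bernoulli gives r⁴ ≥ 1 + 4(r-1) = ρ. Then ρⁿ ω̂(ρ)² is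
bounded by a constant times (r^(2n) ω̂(r))², hence by the square of the moment ω_{2n}. -/
lemma pow_mul_hat_sq_le {ω : ℝ → ℝ} (hω : IsRadialWeight ω) {C : ℝ} (hC : 0 < C)
    (h : ∀ r ∈ Set.Ico (0 : ℝ) 1, hat ω r ≤ C * hat ω ((1 + r) / 2)) {ρ : ℝ}
    (hρ : ρ ∈ Set.Ico (0 : ℝ) 1) (n : ℕ) :
    ρ ^ n * hat ω ρ ^ 2 ≤ C ^ 4 * mom ω (2 * n) ^ 2 := by
  have h0 := hρ.1
  have h1 := hρ.2
  set r := (1 + (1 + ρ) / 2) / 2 with hr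
  have hr0 : 0 ≤ r := by linarith
  have hr1 : r < 1 := by linarith
  have h2 : hat ω ρ ≤ C ^ 2 * hat ω r := by
    calc hat ω ρ ≤ C * (C * hat ω r) := (h ρ hρ).trans
          (mul_le_mul_of_nonneg_left (h _ ⟨by linarith, by linarith⟩) hC.le)
      _ = _ := by ring
  have h3 : ρ ≤ r ^ 4 := by
    have := one_add_mul_le_pow (a := r - 1) (by linarith) 4
    rw [add_sub_cancel] at this
    push_cast at this
    linarith
  have h4 := momentReal_lower (x := 2 * n) (by positivity) ⟨hr0, hr1⟩ hω
  have e : r ^ (2 * (n : ℝ)) = r ^ (2 * n) := by rw [← Real.rpow_natCast]; norm_num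
  rw [e] at h4
  have := hat_nonneg ω r
  calc ρ ^ n * hat ω ρ ^ 2 ≤ (r ^ 4) ^ n * (C ^ 2 * hat ω r) ^ 2 := by
        gcongr
        exact hat_nonneg _ _
    _ = C ^ 4 * (r ^ (2 * n) * hat ω r) ^ 2 := by ring_nf
    _ ≤ _ := by gcongr

/-! ### Circle means of k' -/

lemma norm_mul_conj_circleMap (v : ℂ) (θ : ℝ) : ‖v * conj (circleMap 0 1 θ)‖ = ‖v‖ := by simp

/-- Parseval followed by a geometric series. In the intended use one factor |v|ⁿ of |v|^(2n) pays
for the size of the coefficients, and the other sums to 1/(1-|v|). -/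
lemma integral_norm_sq_le {h : ℂ → ℂ} {c : ℕ → ℂ} (hc : ∀ u ∈ disc, HasSum (fun n => c n * u ^ n) (h u))
    {v : ℂ} (hv : v ∈ disc) {A : ℝ} (hA : ∀ n, ‖c n * v ^ n‖ ^ 2 ≤ A * ‖v‖ ^ n) :
    ∫ θ in Set.Ioo (-Real.pi) Real.pi, ‖h (v * conj (circleMap 0 1 θ))‖ ^ 2 ≤
      2 * Real.pi * (A / (1 - ‖v‖)) := by
  have hd : Summable fun n => ‖c n * v ^ n‖ := (hc v hv).summable.norm
  have h1 : ∀ θ : ℝ, h (v * conj (circleMap 0 1 θ)) =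
      ∑' n, (c n * v ^ n) * conj (circleMap 0 1 θ) ^ n := fun θ => by
    have hu : v * conj (circleMap 0 1 θ) ∈ disc := by
      rw [disc_norm, norm_mul_conj_circleMap]; exact disc_norm.1 hv
    rw [← (hc _ hu).tsum_eq]
    exact tsum_congr fun n => by rw [mul_pow, mul_assoc]
  simp_rw [h1]
  rw [integral_norm_sq_tsum hd]
  have hg := (hasSum_geometric_of_lt_one (norm_nonneg v) (disc_norm.1 hv)).mul_left A
  have h2 : Summable fun n => ‖c n * v ^ n‖ ^ 2 :=
    Summable.of_nonneg_of_le (fun n => sq_nonneg _) hA hg.summable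
  have h3 := h2.tsum_le_tsum hA hg.summable
  rw [hg.tsum_eq, ← div_eq_mul_inv] at h3
  exact mul_le_mul_of_nonneg_left h3 (by positivity)

/-- The integral means of order one of the derivative of the Bergman kernel of an upper doubling
weight. -/
lemma exists_integral_norm_deriv_kern_le {ω : ℝ → ℝ} (h : UpperDoubling ω) :
    ∃ K : ℝ, 0 < K ∧ ∀ v ∈ disc,
      ∫ θ in Set.Ioo (-Real.pi) Real.pi, ‖deriv (kern ω) (v * conj (circleMap 0 1 θ))‖ ≤
        K / ((1 - ‖v‖) * hat ω ‖v‖) := by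
  obtain ⟨C, hC, hdb⟩ := h.exists_const
  obtain ⟨D, hD, hdc⟩ := exists_dcoef_le h
  have hω := h.1
  refine ⟨Real.pi * (D ^ 2 * C ^ 4 + 1), by positivity, fun v hv => ?_⟩
  have hv1 := disc_norm.1 hv
  have hv2 : ‖v‖ ∈ Set.Ico (0 : ℝ) 1 := ⟨norm_nonneg v, hv1⟩
  set t := hat ω ‖v‖ with ht
  have ht0 : 0 < t := hat_pos hω hv2
  have hmem : ∀ θ : ℝ, v * conj (circleMap 0 1 θ) ∈ disc := fun θ => by
    rw [disc_norm, norm_mul_conj_circleMap]; exact hv1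
  have hcm : Continuous fun θ : ℝ => v * conj (circleMap 0 1 θ) := by
    have := continuous_circleMap 0 1
    fun_prop
  have hk : Continuous fun θ : ℝ => deriv (kern ω) (v * conj (circleMap 0 1 θ)) :=
    (continuousOn_deriv_kern hω).comp_continuous hcm hmem
  have hne : ∀ u ∈ disc, (1 - u) ≠ 0 := fun u hu h0 => by
    have : u = 1 := (sub_eq_zero.1 h0).symm
    rw [this, disc_norm] at hu
    simp at hu
  have hki : Continuous fun θ : ℝ => (1 - v * conj (circleMap 0 1 θ))⁻¹ :=
    (continuous_const.sub hcm).inv₀ fun θ => hne _ (hmem θ)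
  have h1 := integral_norm_sq_le (h := fun u => (1 - u) * deriv (kern ω) u)
    (c := fun n => (dcoef ω n : ℂ)) (fun u hu => hasSum_one_sub_mul_deriv_kern hω hu) hv
    (A := D ^ 2 * C ^ 4 / t ^ 2) (fun n => by
      have hm : 0 < mom ω (2 * n) := momentReal_pos hω (by positivity)
      have e := pow_mul_hat_sq_le hω hC hdb hv2 n
      rw [norm_mul, norm_pow, Complex.norm_real, Real.norm_of_nonneg (hdc n).1]
      have e2 : ‖v‖ ^ n / mom ω (2 * n) ^ 2 ≤ C ^ 4 / t ^ 2 := by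
        rw [div_le_div_iff₀ (by positivity) (by positivity)]; exact e
      calc (dcoef ω n * ‖v‖ ^ n) ^ 2 ≤ (D / mom ω (2 * n) * ‖v‖ ^ n) ^ 2 := by
            have := (hdc n).1
            gcongr
            exact (hdc n).2
        _ = D ^ 2 * (‖v‖ ^ n / mom ω (2 * n) ^ 2) * ‖v‖ ^ n := by ring
        _ ≤ D ^ 2 * (C ^ 4 / t ^ 2) * ‖v‖ ^ n := by gcongr
        _ = _ := by ring)
  have h2 := integral_norm_sq_le (h := fun u => (1 - u)⁻¹) (c := fun _ => 1)
    (fun u hu => by simpa using hasSum_geometric_of_norm_lt_one (disc_norm.1 hu)) hv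
    (A := 1) (fun n => by
      rw [one_mul, one_mul, norm_pow]
      exact pow_le_of_le_one (by positivity) (pow_le_one₀ (norm_nonneg _) hv1.le) two_ne_zero)
  have hq1 : Continuous fun θ : ℝ => ‖(1 - v * conj (circleMap 0 1 θ)) *
      deriv (kern ω) (v * conj (circleMap 0 1 θ))‖ ^ 2 :=
    (((continuous_const.sub hcm).mul hk).norm).pow 2
  have hq2 : Continuous fun θ : ℝ => ‖(1 - v * conj (circleMap 0 1 θ))⁻¹‖ ^ 2 := hki.norm.pow 2
  -- Cauchy–Schwarz in the pointwise form b ≤ (t/2)(ab)² + a⁻²/(2t), with a = |1-u| and b = |k'(u)|.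
  -- The weight t = ω̂(|v|) makes both resulting terms of order 1/((1-|v|)t).
  calc ∫ θ in Set.Ioo (-Real.pi) Real.pi, ‖deriv (kern ω) (v * conj (circleMap 0 1 θ))‖
      ≤ ∫ θ in Set.Ioo (-Real.pi) Real.pi, ((t / 2) * ‖(1 - v * conj (circleMap 0 1 θ)) *
          deriv (kern ω) (v * conj (circleMap 0 1 θ))‖ ^ 2 +
          (1 / (2 * t)) * ‖(1 - v * conj (circleMap 0 1 θ))⁻¹‖ ^ 2) := by
        refine integral_mono (integrableOn_Ioo_of_continuous hk.norm _ _)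
          (((integrableOn_Ioo_of_continuous hq1 _ _).const_mul _).add
            ((integrableOn_Ioo_of_continuous hq2 _ _).const_mul _)) fun θ => ?_
        have hn := norm_pos_iff.2 (hne _ (hmem θ))
        simp only [norm_mul (1 - v * conj (circleMap 0 1 θ)), norm_inv]
        generalize ‖1 - v * conj (circleMap 0 1 θ)‖ = a at hn
        generalize ‖deriv (kern ω) (v * conj (circleMap 0 1 θ))‖ = b
        have : t / 2 * (a * b) ^ 2 + 1 / (2 * t) * a⁻¹ ^ 2 - b = (t * a * b - a⁻¹) ^ 2 / (2 * t) := by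
          field_simp; ring
        have h3 : 0 ≤ (t * a * b - a⁻¹) ^ 2 / (2 * t) := by positivity
        linarith
    _ = (t / 2) * (∫ θ in Set.Ioo (-Real.pi) Real.pi, ‖(1 - v * conj (circleMap 0 1 θ)) *
          deriv (kern ω) (v * conj (circleMap 0 1 θ))‖ ^ 2) +
        (1 / (2 * t)) * ∫ θ in Set.Ioo (-Real.pi) Real.pi,
          ‖(1 - v * conj (circleMap 0 1 θ))⁻¹‖ ^ 2 := by
        rw [integral_add ((integrableOn_Ioo_of_continuous hq1 _ _).const_mul _)
          ((integrableOn_Ioo_of_continuous hq2 _ _).const_mul _), integral_const_mul,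
          integral_const_mul]
    _ ≤ (t / 2) * (2 * Real.pi * (D ^ 2 * C ^ 4 / t ^ 2 / (1 - ‖v‖))) +
        (1 / (2 * t)) * (2 * Real.pi * (1 / (1 - ‖v‖))) :=
        add_le_add (mul_le_mul_of_nonneg_left h1 (half_pos ht0).le)
          (mul_le_mul_of_nonneg_left h2 (one_div_pos.2 (mul_pos two_pos ht0)).le)
    _ = _ := by
        have : 0 < 1 - ‖v‖ := by linarith
        field_simp

/-! ### The radial integral -/

lemma lintegral_Ico_div_le {ω : ℝ → ℝ} (hω : IsRadialWeight ω) {C : ℝ} (hC : 0 < C) {a r : ℝ}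
    (ha : 0 ≤ a) (har : a ≤ r) (hr : r < 1) (h : hat ω a ≤ C * hat ω r) :
    ∫⁻ s in Set.Ico a r, ENNReal.ofReal (ω s / ((1 - s) * hat ω s)) ≤
      ENNReal.ofReal (C / (1 - r)) := by
  have hr1 : 0 < 1 - r := by linarith
  have hp := hat_pos hω (r := r) ⟨ha.trans har, hr⟩
  calc ∫⁻ s in Set.Ico a r, ENNReal.ofReal (ω s / ((1 - s) * hat ω s))
      ≤ ∫⁻ s in Set.Ico a r, ENNReal.ofReal (1 / ((1 - r) * hat ω r)) * ENNReal.ofReal (ω s) := by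
        refine setLIntegral_mono' measurableSet_Ico fun s hs => ?_
        have hs0 := ha.trans hs.1
        rw [← ENNReal.ofReal_mul (by positivity)]
        refine ENNReal.ofReal_le_ofReal ?_
        rw [div_mul_eq_mul_div, one_mul]
        refine div_le_div_of_nonneg_left (hω.nonneg s ⟨hs0, hs.2.trans hr⟩) (by positivity) ?_
        exact mul_le_mul (by linarith [hs.2]) (hat_anti hω hs0 hs.2.le) hp.le (by linarith [hs.2])
    _ = ENNReal.ofReal (1 / ((1 - r) * hat ω r)) * ∫⁻ s in Set.Ico a r, ENNReal.ofReal (ω s) :=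
        lintegral_const_mul' _ _ ENNReal.ofReal_ne_top
    _ ≤ ENNReal.ofReal (1 / ((1 - r) * hat ω r)) * tail ω a :=
        mul_le_mul_right (lintegral_mono_set (Set.Ico_subset_Ico_right hr.le)) _
    _ ≤ ENNReal.ofReal (1 / ((1 - r) * hat ω r)) * ENNReal.ofReal (C * hat ω r) := by
        rw [← ofReal_hat hω ha]
        exact mul_le_mul_right (ENNReal.ofReal_le_ofReal h) _
    _ = _ := by
        rw [← ENNReal.ofReal_mul (by positivity)]
        congr 1; field_simp

/-- Dyadic induction: passing from r to 2r-1 doubles the distance to 1. The new piece [2r-1, r)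
costs C/(1-r) and the induction hypothesis gives 2C/(2(1-r)), so the constant 2C reproduces itself.
The parameter k only bounds the number of steps. -/
lemma lintegral_div_hat_le {ω : ℝ → ℝ} (hω : IsRadialWeight ω) {C : ℝ} (hC : 0 < C)
    (h : ∀ r ∈ Set.Ico (0 : ℝ) 1, hat ω r ≤ C * hat ω ((1 + r) / 2)) (k : ℕ) :
    ∀ r ∈ Set.Ico (0 : ℝ) 1, (1 / 2) ^ k ≤ 1 - r →
    ∫⁻ s in Set.Ico 0 r, ENNReal.ofReal (ω s / ((1 - s) * hat ω s)) ≤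
      ENNReal.ofReal (2 * C / (1 - r)) := by
  induction k with
  | zero =>
    intro r hr hk
    have : r = 0 := by
      have := hr.1
      simp at hk; linarith
    simp [this]
  | succ k ih =>
    intro r hr hk
    have hr1 : 0 < 1 - r := by linarith [hr.2]
    rcases lt_or_ge r (1 / 2) with h2 | h2
    · have h3 := h 0 ⟨le_rfl, one_pos⟩
      refine (lintegral_Ico_div_le hω hC le_rfl hr.1 hr.2 (h3.trans ?_)).trans
        (ENNReal.ofReal_le_ofReal ?_)
      · exact mul_le_mul_of_nonneg_left (hat_anti hω hr.1 (by linarith)) hC.le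
      · gcongr; linarith
    · have ha : 2 * r - 1 ∈ Set.Ico (0 : ℝ) 1 := ⟨by linarith, by linarith⟩
      have har : 2 * r - 1 ≤ r := by linarith
      have h3 := h _ ha
      rw [show (1 + (2 * r - 1)) / 2 = r by ring] at h3
      rw [← Set.Ico_union_Ico_eq_Ico ha.1 har]
      refine (lintegral_union_le _ _ _).trans ((add_le_add (ih _ ha ?_)
        (lintegral_Ico_div_le hω hC ha.1 har hr.2 h3)).trans ?_)
      · rw [pow_succ] at hk; linarith
      · have e : 1 - (2 * r - 1) = 2 * (1 - r) := by ring
        rw [e, ← ENNReal.ofReal_add (by positivity) (by positivity)]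
        refine ENNReal.ofReal_le_ofReal (le_of_eq ?_)
        field_simp; ring

/-- Split at r. For s < r replace rs by s and ν̂(s) by ν̂(r), leaving the integral just bounded. For
s ≥ r replace rs by r, leaving σ̂(r)/((1-r)ω̂(r)), to which the tail condition applies. -/
lemma exists_radial_lintegral_le {ω ν : ℝ → ℝ} (hω : UpperDoubling ω) (hν : IsRadialWeight ν)
    (hσ : IsRadialWeight (quot ω ν)) {A : ℝ} (hA : 0 < A)
    (h : ∀ r ∈ Set.Ico (0 : ℝ) 1, hat ν r * hat (quot ω ν) r ≤ A * hat ω r) :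
    ∃ K : ℝ, 0 < K ∧ ∀ r ∈ Set.Ico (0 : ℝ) 1,
      ∫⁻ s in Set.Ico 0 1, ENNReal.ofReal (quot ω ν s / ((1 - r * s) * hat ω (r * s))) ≤
        ENNReal.ofReal (K / ((1 - r) * hat ν r)) := by
  obtain ⟨C, hC, hdb⟩ := hω.exists_const
  refine ⟨2 * C + A, by positivity, fun r hr => ?_⟩
  have hr0 := hr.1
  have hr1 : 0 < 1 - r := by linarith [hr.2]
  have hpν := hat_pos hν hr
  have hpω := hat_pos hω.1 hr
  rw [← Set.Ico_union_Ico_eq_Ico hr0 hr.2.le]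
  refine (lintegral_union_le _ _ _).trans ?_
  rw [add_div, ENNReal.ofReal_add (by positivity) (by positivity)]
  refine add_le_add ?_ ?_
  · obtain ⟨k, hk⟩ := exists_pow_lt_of_lt_one hr1 (show (1 / 2 : ℝ) < 1 by norm_num)
    calc ∫⁻ s in Set.Ico 0 r, ENNReal.ofReal (quot ω ν s / ((1 - r * s) * hat ω (r * s)))
        ≤ ∫⁻ s in Set.Ico 0 r, ENNReal.ofReal (1 / hat ν r) *
            ENNReal.ofReal (ω s / ((1 - s) * hat ω s)) := by
          refine setLIntegral_mono' measurableSet_Ico fun s hs => ?_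
          have hs0 := hs.1
          have hs1 : s < 1 := hs.2.trans hr.2
          have hps := hat_pos hω.1 ⟨hs0, hs1⟩
          have hns := hat_pos hν ⟨hs0, hs1⟩
          have hw := hω.1.nonneg s ⟨hs0, hs1⟩
          have hs2 : 0 < 1 - s := by linarith
          have hrs : r * s ≤ s := mul_le_of_le_one_left hs0 hr.2.le
          rw [← ENNReal.ofReal_mul (by positivity)]
          refine ENNReal.ofReal_le_ofReal ?_
          rw [div_mul_div_comm, one_mul]
          unfold quot
          rw [div_div]
          refine div_le_div_of_nonneg_left hw (by positivity) ?_
          refine mul_le_mul (hat_anti hν hs0 hs.2.le) ?_ (by positivity) hns.le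
          exact mul_le_mul (by linarith) (hat_anti hω.1 (mul_nonneg hr0 hs0) hrs) hps.le
            (by linarith)
      _ = ENNReal.ofReal (1 / hat ν r) * _ := lintegral_const_mul' _ _ ENNReal.ofReal_ne_top
      _ ≤ ENNReal.ofReal (1 / hat ν r) * ENNReal.ofReal (2 * C / (1 - r)) :=
          mul_le_mul_right (lintegral_div_hat_le hω.1 hC hdb k r hr hk.le) _
      _ = _ := by
          rw [← ENNReal.ofReal_mul (by positivity)]
          congr 1; field_simp
  · calc ∫⁻ s in Set.Ico r 1, ENNReal.ofReal (quot ω ν s / ((1 - r * s) * hat ω (r * s)))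
        ≤ ∫⁻ s in Set.Ico r 1, ENNReal.ofReal (1 / ((1 - r) * hat ω r)) *
            ENNReal.ofReal (quot ω ν s) := by
          refine setLIntegral_mono' measurableSet_Ico fun s hs => ?_
          have hs0 := hr0.trans hs.1
          have hrs : r * s ≤ r := mul_le_of_le_one_right hr0 hs.2.le
          rw [← ENNReal.ofReal_mul (by positivity)]
          refine ENNReal.ofReal_le_ofReal ?_
          rw [div_mul_eq_mul_div, one_mul]
          refine div_le_div_of_nonneg_left (hσ.nonneg s ⟨hs0, hs.2⟩) (by positivity) ?_
          exact mul_le_mul (by linarith) (hat_anti hω.1 (mul_nonneg hr0 hs0) hrs) hpω.le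
            (by linarith)
      _ = ENNReal.ofReal (1 / ((1 - r) * hat ω r)) * tail (quot ω ν) r :=
          lintegral_const_mul' _ _ ENNReal.ofReal_ne_top
      _ = ENNReal.ofReal (1 / ((1 - r) * hat ω r) * hat (quot ω ν) r) := by
          rw [← ofReal_hat hσ hr0, ← ENNReal.ofReal_mul (by positivity)]
      _ ≤ _ := by
          refine ENNReal.ofReal_le_ofReal ?_
          rw [div_mul_eq_mul_div, one_mul, div_le_div_iff₀ (by positivity) (by positivity)]
          nlinarith [h r hr, mul_le_mul_of_nonneg_left (h r hr) hr1.le]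

/-! ### Area integrals of |k'| against σ -/

lemma circleMap_eq_mul (r θ : ℝ) : circleMap 0 r θ = r * circleMap 0 1 θ := by
  simp [circleMap]

/-- Only the upper bound is needed, and in this form no measurability of F is required. -/
lemma lintegral_area_le (F : ℂ → ℝ≥0∞) :
    ∫⁻ ζ, F ζ ∂area ≤ (ENNReal.ofReal Real.pi)⁻¹ * ∫⁻ r in Set.Ico (0 : ℝ) 1,
      ∫⁻ θ in Set.Ioo (-Real.pi) Real.pi, ENNReal.ofReal r * F (circleMap 0 r θ) := by
  unfold area
  rw [lintegral_smul_measure, smul_eq_mul]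
  refine mul_le_mul_right ?_ _
  rw [← lintegral_indicator (show MeasurableSet disc from Metric.isOpen_ball.measurableSet),
    ← Complex.lintegral_comp_polarCoord_symm]
  have ht : polarCoord.target = Set.Ioi (0 : ℝ) ×ˢ Set.Ioo (-Real.pi) Real.pi := rfl
  rw [ht, Measure.volume_eq_prod, ← Measure.prod_restrict]
  refine (lintegral_prod_le _).trans ?_
  rw [← lintegral_indicator measurableSet_Ioi, ← lintegral_indicator measurableSet_Ico]
  refine lintegral_mono fun r => ?_
  by_cases hr : 0 < r
  · have hval : ∀ θ : ℝ, Complex.polarCoord.symm (r, θ) = circleMap 0 r θ := by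
      intro θ
      simp [circleMap, Complex.exp_mul_I]
    by_cases hr1 : r < 1
    · rw [Set.indicator_of_mem (show r ∈ Set.Ioi (0 : ℝ) from hr),
        Set.indicator_of_mem (show r ∈ Set.Ico (0 : ℝ) 1 from ⟨hr.le, hr1⟩)]
      refine lintegral_mono fun θ => ?_
      simp only [hval, smul_eq_mul]
      exact mul_le_mul_right (Set.indicator_le_self _ _ _) _
    · have hn : ∀ θ : ℝ, circleMap 0 r θ ∉ disc := fun θ => by
        rw [disc_norm, norm_circleMap_zero, abs_of_pos hr]; exact hr1
      rw [Set.indicator_of_mem (show r ∈ Set.Ioi (0 : ℝ) from hr)]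
      simp [hval, hn]
  · rw [Set.indicator_of_notMem (by simpa using hr)]
    exact zero_le

lemma mul_conj_mem_disc {z ζ : ℂ} (hz : z ∈ disc) (hζ : ζ ∈ disc) : z * conj ζ ∈ disc := by
  rw [disc_norm] at *
  rw [norm_mul, RCLike.norm_conj]
  nlinarith [norm_nonneg z, norm_nonneg ζ]

/-- The key integral estimate for the derivative of the Bergman kernel. -/
lemma exists_lintegral_deriv_kern_le {ω ν : ℝ → ℝ} (hω : UpperDoubling ω) (hν : IsRadialWeight ν)
    (h : TailCondition ω ν) :
    ∃ K : ℝ, 0 < K ∧ ∀ z ∈ disc,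
      ∫⁻ ζ, ENNReal.ofReal (quot ω ν ‖ζ‖) * ‖deriv (kern ω) (z * conj ζ)‖ₑ ∂area ≤
        ENNReal.ofReal (K / ((1 - ‖z‖) * hat ν ‖z‖)) := by
  obtain ⟨hσ, A, hA, hle⟩ := (tailCondition_iff hω.1 hν).1 h
  obtain ⟨K, hK, hrad⟩ := exists_radial_lintegral_le hω hν hσ hA hle
  obtain ⟨M, hM, hmean⟩ := exists_integral_norm_deriv_kern_le hω
  have hpi := Real.pi_pos
  refine ⟨M / Real.pi * K, by positivity, fun z hz => ?_⟩
  have hz1 := disc_norm.1 hz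
  have hinner : ∀ s ∈ Set.Ico (0 : ℝ) 1, ∫⁻ θ in Set.Ioo (-Real.pi) Real.pi,
      ENNReal.ofReal s * (ENNReal.ofReal (quot ω ν ‖circleMap 0 s θ‖) *
        ‖deriv (kern ω) (z * conj (circleMap 0 s θ))‖ₑ) ≤
      ENNReal.ofReal M *
        ENNReal.ofReal (quot ω ν s / ((1 - ‖z‖ * s) * hat ω (‖z‖ * s))) := by
    intro s hs
    have hs0 := hs.1
    have hs1 := hs.2
    have hv : z * s ∈ disc := by
      rw [disc_norm, norm_mul, Complex.norm_real, Real.norm_of_nonneg hs0]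
      nlinarith [norm_nonneg z]
    have hvn : ‖z * (s : ℂ)‖ = ‖z‖ * s := by
      rw [norm_mul, Complex.norm_real, Real.norm_of_nonneg hs0]
    have e : ∀ θ : ℝ, z * conj (circleMap 0 s θ) = z * s * conj (circleMap 0 1 θ) := fun θ => by
      rw [circleMap_eq_mul s, map_mul, Complex.conj_ofReal, mul_assoc]
    have hk : Continuous fun θ : ℝ => deriv (kern ω) (z * s * conj (circleMap 0 1 θ)) := by
      refine (continuousOn_deriv_kern hω.1).comp_continuous ?_ fun θ => ?_
      · have := continuous_circleMap 0 1
        fun_prop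
      · rw [disc_norm, norm_mul_conj_circleMap]; exact disc_norm.1 hv
    have h1 := hmean _ hv
    have hq := hσ.nonneg s hs
    simp only [norm_circleMap_zero, abs_of_nonneg hs0, e]
    rw [lintegral_const_mul' _ _ ENNReal.ofReal_ne_top,
      lintegral_const_mul' _ _ ENNReal.ofReal_ne_top,
      ← ofReal_integral_norm_eq_lintegral_enorm (integrableOn_Ioo_of_continuous hk _ _),
      ← ENNReal.ofReal_mul hq, ← ENNReal.ofReal_mul hs0, ← ENNReal.ofReal_mul hM.le]
    refine ENNReal.ofReal_le_ofReal ?_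
    rw [hvn] at h1
    have h0 : 0 ≤ ∫ θ in Set.Ioo (-Real.pi) Real.pi,
        ‖deriv (kern ω) (z * s * conj (circleMap 0 1 θ))‖ := integral_nonneg fun _ => norm_nonneg _
    calc s * (quot ω ν s * ∫ θ in Set.Ioo (-Real.pi) Real.pi,
          ‖deriv (kern ω) (z * s * conj (circleMap 0 1 θ))‖)
        ≤ quot ω ν s * ∫ θ in Set.Ioo (-Real.pi) Real.pi,
          ‖deriv (kern ω) (z * s * conj (circleMap 0 1 θ))‖ :=
          mul_le_of_le_one_left (mul_nonneg hq h0) hs1.le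
      _ ≤ quot ω ν s * (M / ((1 - ‖z‖ * s) * hat ω (‖z‖ * s))) :=
          mul_le_mul_of_nonneg_left h1 hq
      _ = _ := by rw [mul_div_assoc', mul_div_assoc', mul_comm M]
  refine (lintegral_area_le _).trans ?_
  calc _ ≤ (ENNReal.ofReal Real.pi)⁻¹ * ∫⁻ s in Set.Ico (0 : ℝ) 1, ENNReal.ofReal M *
        ENNReal.ofReal (quot ω ν s / ((1 - ‖z‖ * s) * hat ω (‖z‖ * s))) :=
        mul_le_mul_right (setLIntegral_mono' measurableSet_Ico hinner) _
    _ ≤ (ENNReal.ofReal Real.pi)⁻¹ * (ENNReal.ofReal M *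
        ENNReal.ofReal (K / ((1 - ‖z‖) * hat ν ‖z‖))) := by
        rw [lintegral_const_mul' _ _ ENNReal.ofReal_ne_top]
        gcongr
        exact hrad _ ⟨norm_nonneg z, hz1⟩
    _ = _ := by
        rw [← ENNReal.ofReal_inv_of_pos hpi, ← ENNReal.ofReal_mul hM.le,
          ← ENNReal.ofReal_mul (by positivity)]
        congr 1; ring

/-! ### Sufficiency: differentiating the projection -/

lemma MemGrowth.ae_norm_mul_le {ω ν : ℝ → ℝ} (hω : IsRadialWeight ω) (hν : IsRadialWeight ν)
    {f : ℂ → ℂ} (hf : MemGrowth (hat ν) f) :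
    ∀ᵐ ζ ∂area, ‖f ζ * (ω ‖ζ‖ : ℂ)‖ ≤ (growthNorm (hat ν) f).toReal * quot ω ν ‖ζ‖ := by
  have h1 : ∀ᵐ ζ ∂area, ‖f ζ‖ₑ * ENNReal.ofReal (hat ν ‖ζ‖) ≤ growthNorm (hat ν) f :=
    ENNReal.ae_le_essSup _
  filter_upwards [h1, ae_area fun ζ hζ => hζ] with ζ h2 hζ
  have hm : ‖ζ‖ ∈ Set.Ico (0 : ℝ) 1 := ⟨norm_nonneg _, disc_norm.1 hζ⟩
  have hp := hat_pos hν hm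
  have h3 := ENNReal.toReal_mono hf.2.ne h2
  rw [ENNReal.toReal_mul, ENNReal.toReal_ofReal hp.le, toReal_enorm] at h3
  have hw := hω.nonneg _ hm
  rw [norm_mul, Complex.norm_real, Real.norm_of_nonneg hw]
  calc ‖f ζ‖ * ω ‖ζ‖ = (‖f ζ‖ * hat ν ‖ζ‖) * quot ω ν ‖ζ‖ := by unfold quot; field_simp
    _ ≤ _ := mul_le_mul_of_nonneg_right h3 (div_nonneg hw hp.le)

lemma MemGrowth.integrable_mul {ω ν : ℝ → ℝ} (hω : IsRadialWeight ω) (hν : IsRadialWeight ν)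
    (hσ : IsRadialWeight (quot ω ν)) {f : ℂ → ℂ} (hf : MemGrowth (hat ν) f) :
    Integrable (fun ζ => f ζ * (ω ‖ζ‖ : ℂ)) area :=
  ((integrable_weight hσ).const_mul _).mono'
    (hf.1.mul (Complex.continuous_ofReal.comp_aestronglyMeasurable (integrable_weight hω).1))
    (hf.ae_norm_mul_le hω hν)

lemma projIntegrand_eq (ω : ℝ → ℝ) (f : ℂ → ℂ) (z ζ : ℂ) :
    projIntegrand ω f z ζ = f ζ * (ω ‖ζ‖ : ℂ) * kern ω (z * conj ζ) := by
  rw [projIntegrand, conj_bergmanKernel]; ring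

lemma aestronglyMeasurable_comp_mul_conj {k : ℂ → ℂ} (hk : ContinuousOn k disc) {z : ℂ}
    (hz : z ∈ disc) : AEStronglyMeasurable (fun ζ => k (z * conj ζ)) area :=
  aesm_area (hk.comp (by fun_prop) fun _ hζ => mul_conj_mem_disc hz hζ)

lemma integrable_projIntegrand {ω : ℝ → ℝ} (hω : IsRadialWeight ω) {f : ℂ → ℂ}
    (hf : Integrable (fun ζ => f ζ * (ω ‖ζ‖ : ℂ)) area) {z : ℂ} (hz : z ∈ disc) :
    Integrable (projIntegrand ω f z) area := by
  obtain ⟨K, hK⟩ := kernel_bounded hω hz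
  refine (Integrable.mul_bdd (c := K) hf (aestronglyMeasurable_comp_mul_conj
    (differentiableOn_kern hω).continuousOn hz) (ae_area fun ζ hζ => ?_)).congr
    (ae_of_all _ fun ζ => (projIntegrand_eq ω f z ζ).symm)
  rw [← conj_bergmanKernel, RCLike.norm_conj]
  exact hK ζ hζ

/-- For x in a ball of radius R < 1 the points xζ̄ stay in the closed ball of radius R, where k' is
bounded by compactness. Hence a constant multiple of |fω| dominates the differentiated integrands.
-/
lemma hasDerivAt_bergmanProj {ω : ℝ → ℝ} (hω : IsRadialWeight ω) {f : ℂ → ℂ}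
    (hf : Integrable (fun ζ => f ζ * (ω ‖ζ‖ : ℂ)) area) {z : ℂ} (hz : z ∈ disc) :
    HasDerivAt (bergmanProj ω f)
      (∫ ζ, f ζ * (ω ‖ζ‖ : ℂ) * (deriv (kern ω) (z * conj ζ) * conj ζ) ∂area) z := by
  obtain ⟨R, hR0, hR1, hR⟩ := exists_ball_of_mem_disc hz
  have hsub : Metric.closedBall (0 : ℂ) R ⊆ disc := Metric.closedBall_subset_ball hR1
  obtain ⟨B, hB⟩ := (isCompact_closedBall (0 : ℂ) R).exists_bound_of_continuousOn
    ((continuousOn_deriv_kern hω).mono hsub)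
  have hmem : ∀ x ∈ Metric.ball (0 : ℂ) R, ∀ ζ ∈ disc, x * conj ζ ∈ Metric.closedBall (0 : ℂ) R := by
    intro x hx ζ hζ
    rw [mem_ball_zero_iff] at hx
    rw [mem_closedBall_zero_iff, norm_mul, RCLike.norm_conj]
    exact (mul_le_of_le_one_right (norm_nonneg _) (disc_norm.1 hζ).le).trans hx.le
  have hcj : AEStronglyMeasurable (fun ζ : ℂ => conj ζ) area :=
    Continuous.aestronglyMeasurable (by fun_prop)
  have h := (hasDerivAt_integral_of_dominated_loc_of_deriv_le (μ := area) (𝕜 := ℂ)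
    (F := fun z ζ => f ζ * (ω ‖ζ‖ : ℂ) * kern ω (z * conj ζ))
    (F' := fun z ζ => f ζ * (ω ‖ζ‖ : ℂ) * (deriv (kern ω) (z * conj ζ) * conj ζ))
    (bound := fun ζ => ‖f ζ * (ω ‖ζ‖ : ℂ)‖ * B) (Metric.isOpen_ball.mem_nhds hR) ?_ ?_ ?_ ?_ ?_ ?_).2
  · refine h.congr_of_eventuallyEq (Eventually.of_forall fun x => ?_)
    exact integral_congr_ae (ae_of_all _ fun ζ => projIntegrand_eq ω f x ζ)
  · filter_upwards [Metric.isOpen_ball.mem_nhds hz] with x hx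
    exact hf.1.mul (aestronglyMeasurable_comp_mul_conj (differentiableOn_kern hω).continuousOn hx)
  · exact (integrable_projIntegrand hω hf hz).congr
      (ae_of_all _ fun ζ => projIntegrand_eq ω f z ζ)
  · exact hf.1.mul ((aestronglyMeasurable_comp_mul_conj (continuousOn_deriv_kern hω) hz).mul hcj)
  · refine ae_area fun ζ hζ x hx => ?_
    rw [norm_mul, norm_mul (deriv _ _), RCLike.norm_conj]
    refine mul_le_mul_of_nonneg_left ?_ (norm_nonneg _)
    exact (mul_le_of_le_one_right (norm_nonneg _) (disc_norm.1 hζ).le).trans (hB _ (hmem x hx ζ hζ))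
  · exact hf.norm.mul_const B
  · refine ae_area fun ζ hζ x hx => ?_
    have hd := ((differentiableOn_kern hω).differentiableAt
      (Metric.isOpen_ball.mem_nhds (hsub (hmem x hx ζ hζ)))).hasDerivAt
    exact (hd.comp x (by simpa using (hasDerivAt_id x).mul_const (conj ζ))).const_mul _

lemma boundedGrowthToBloch_of_tailCondition {ω ν : ℝ → ℝ} (hω : UpperDoubling ω)
    (hν : IsRadialWeight ν) (h : TailCondition ω ν) : BoundedGrowthToBloch ω (hat ν) := by
  obtain ⟨hσ, -⟩ := (tailCondition_iff hω.1 hν).1 h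
  obtain ⟨K, hK, hle⟩ := exists_lintegral_deriv_kern_le hω hν h
  refine ⟨K.toNNReal, fun f hf => ?_⟩
  have hfi := hf.integrable_mul hω.1 hν hσ
  have hN : ENNReal.ofReal (growthNorm (hat ν) f).toReal = growthNorm (hat ν) f :=
    ENNReal.ofReal_toReal hf.2.ne
  have hbl : blochNorm (hat ν) (bergmanProj ω f) ≤ K.toNNReal * growthNorm (hat ν) f := by
    refine iSup₂_le fun z hz => ?_
    have hz1 := disc_norm.1 hz
    have hp := hat_pos hν (r := ‖z‖) ⟨norm_nonneg z, hz1⟩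
    have hz2 : 0 < 1 - ‖z‖ := by linarith
    have hd : ‖deriv (bergmanProj ω f) z‖ₑ ≤
        growthNorm (hat ν) f * ENNReal.ofReal (K / ((1 - ‖z‖) * hat ν ‖z‖)) := by
      rw [(hasDerivAt_bergmanProj hω.1 hfi hz).deriv]
      refine (enorm_integral_le_lintegral_enorm _).trans
        (le_trans ?_ (mul_le_mul_right (hle z hz) _))
      rw [← lintegral_const_mul' _ _ hf.2.ne]
      refine lintegral_mono_ae ?_
      filter_upwards [hf.ae_norm_mul_le hω.1 hν, ae_area fun ζ hζ => hζ] with ζ h1 hζ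
      rw [enorm_mul, enorm_mul (deriv _ _), ← mul_assoc, ← mul_assoc]
      refine (mul_le_of_le_one_right' ?_).trans (mul_le_mul' ?_ le_rfl)
      · rw [← ofReal_norm, RCLike.norm_conj, ENNReal.ofReal_le_one]
        exact (disc_norm.1 hζ).le
      · rw [← hN, ← ENNReal.ofReal_mul ENNReal.toReal_nonneg, ← ofReal_norm]
        exact ENNReal.ofReal_le_ofReal h1
    rw [ENNReal.ofReal_mul (by positivity), ofReal_norm]
    calc _ ≤ ENNReal.ofReal ((1 - ‖z‖) * hat ν ‖z‖) * (growthNorm (hat ν) f *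
          ENNReal.ofReal (K / ((1 - ‖z‖) * hat ν ‖z‖))) := mul_le_mul_right hd _
      _ = ENNReal.ofReal ((1 - ‖z‖) * hat ν ‖z‖ * (K / ((1 - ‖z‖) * hat ν ‖z‖))) *
          growthNorm (hat ν) f := by
          rw [ENNReal.ofReal_mul (p := (1 - ‖z‖) * hat ν ‖z‖) (by positivity)]; ring
      _ = _ := by
          rw [mul_div_cancel₀ _ (by positivity)]; rfl
  refine ⟨fun z hz => integrable_projIntegrand hω.1 hfi hz, ⟨fun z hz =>
    (hasDerivAt_bergmanProj hω.1 hfi hz).differentiableAt.differentiableWithinAt, ?_⟩, hbl⟩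
  exact hbl.trans_lt (ENNReal.mul_lt_top ENNReal.coe_lt_top hf.2)

/-! ### Necessity: test functions -/

/-- The unimodular monomial `(ζ / |ζ|)ⁿ` divided by `ν̂`. -/
def testFun (ν : ℝ → ℝ) (n : ℕ) (ζ : ℂ) : ℂ := (ζ / (‖ζ‖ : ℂ)) ^ n / (hat ν ‖ζ‖ : ℂ)

lemma growthNorm_testFun_le {ν : ℝ → ℝ} (hν : IsRadialWeight ν) (n : ℕ) :
    growthNorm (hat ν) (testFun ν n) ≤ 1 := by
  refine essSup_le_of_ae_le _ (ae_area fun ζ hζ => ?_)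
  have hp := hat_pos hν (r := ‖ζ‖) ⟨norm_nonneg _, disc_norm.1 hζ⟩
  simp only
  rw [← ofReal_norm, ← ENNReal.ofReal_mul (norm_nonneg _), ENNReal.ofReal_le_one, testFun,
    norm_div, norm_pow, norm_div, Complex.norm_real, Complex.norm_real, norm_norm,
    Real.norm_of_nonneg hp.le, div_mul_cancel₀ _ hp.ne']
  exact pow_le_one₀ (by positivity) (div_self_le_one _)

lemma memGrowth_testFun {ν : ℝ → ℝ} (hν : IsRadialWeight ν) (n : ℕ) :
    MemGrowth (hat ν) (testFun ν n) := by
  refine ⟨Measurable.aestronglyMeasurable ?_,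
    (growthNorm_testFun_le hν n).trans_lt ENNReal.one_lt_top⟩
  have := (measurable_hat ν).comp (measurable_norm (α := ℂ))
  unfold testFun
  exact ((measurable_id.div (Complex.measurable_ofReal.comp measurable_norm)).pow_const n).div
    (Complex.measurable_ofReal.comp this)

/-- The polar factor s is at least 1/2 on [1/2, 1), so area integrability controls σ there. On [0,
1/2) the denominator ν̂ is bounded below and ω is integrable. -/
lemma isRadialWeight_of_integrable_area {ω ν : ℝ → ℝ} (hω : IsRadialWeight ω)
    (hν : IsRadialWeight ν) (h : Integrable (fun ζ : ℂ => quot ω ν ‖ζ‖) area) :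
    IsRadialWeight (quot ω ν) := by
  refine isRadialWeight_quot hω hν ?_
  have hn : ∀ s ∈ Set.Ico (0 : ℝ) 1, 0 ≤ quot ω ν s := fun s hs =>
    div_nonneg (hω.nonneg s hs) (hat_nonneg _ _)
  have hdm : MeasurableSet disc := Metric.isOpen_ball.measurableSet
  have h1 : IntegrableOn (fun ζ : ℂ => quot ω ν ‖ζ‖) disc := by
    unfold area at h
    rw [integrable_smul_measure (by simp) (by simp [Real.pi_pos])] at h
    exact h
  have h2 : Integrable (fun ζ : ℂ => (Set.Ico (0 : ℝ) 1).indicator (quot ω ν) ‖ζ‖) := by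
    refine ((integrable_indicator_iff hdm).2 h1).congr (ae_of_all _ fun ζ => ?_)
    by_cases hζ : ‖ζ‖ < 1 <;> simp [Set.indicator, disc_norm, hζ]
  rw [integrable_fun_norm_addHaar, Complex.finrank_real_complex] at h2
  have h3 := (h2.mono_set (fun s hs => lt_of_lt_of_le (by norm_num) hs.1 :
    Set.Ico (1 / 2 : ℝ) 1 ⊆ Set.Ioi 0)).lintegral_lt_top
  have hh : (1 / 2 : ℝ) ∈ Set.Ico (0 : ℝ) 1 := ⟨by norm_num, by norm_num⟩
  unfold tail
  rw [← Set.Ico_union_Ico_eq_Ico hh.1 hh.2.le]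
  refine (lintegral_union_le _ _ _).trans_lt (ENNReal.add_lt_top.2 ⟨?_, ?_⟩)
  · calc ∫⁻ s in Set.Ico 0 (1 / 2 : ℝ), ENNReal.ofReal (quot ω ν s)
        ≤ ∫⁻ s in Set.Ico 0 (1 / 2 : ℝ), ENNReal.ofReal (1 / hat ν (1 / 2)) *
            ENNReal.ofReal (ω s) := by
          refine setLIntegral_mono' measurableSet_Ico fun s hs => ?_
          have hp := hat_pos hν hh
          rw [← ENNReal.ofReal_mul (by positivity)]
          refine ENNReal.ofReal_le_ofReal ?_
          rw [div_mul_eq_mul_div, one_mul]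
          exact div_le_div_of_nonneg_left (hω.nonneg s ⟨hs.1, hs.2.trans hh.2⟩) hp
            (hat_anti hν hs.1 hs.2.le)
      _ ≤ ENNReal.ofReal (1 / hat ν (1 / 2)) * tail ω 0 := by
          rw [lintegral_const_mul' _ _ ENNReal.ofReal_ne_top]
          exact mul_le_mul_right (lintegral_mono_set (Set.Ico_subset_Ico_right hh.2.le)) _
      _ < ∞ := ENNReal.mul_lt_top ENNReal.ofReal_lt_top (tail_lt_top hω le_rfl)
  · refine lt_of_le_of_lt (b := ENNReal.ofReal 2 * ∫⁻ s in Set.Ico (1 / 2 : ℝ) 1,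
      ENNReal.ofReal (s ^ (2 - 1) • (Set.Ico (0 : ℝ) 1).indicator (quot ω ν) s)) ?_
      (ENNReal.mul_lt_top ENNReal.ofReal_lt_top h3)
    rw [← lintegral_const_mul' _ _ ENNReal.ofReal_ne_top]
    refine setLIntegral_mono' measurableSet_Ico fun s hs => ?_
    have hs1 := hs.1
    have hs2 : s ∈ Set.Ico (0 : ℝ) 1 := ⟨by linarith, hs.2⟩
    rw [← ENNReal.ofReal_mul (by norm_num)]
    refine ENNReal.ofReal_le_ofReal ?_
    simp only [Set.indicator_of_mem hs2, Nat.add_one_sub_one, pow_one, smul_eq_mul]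
    have := hn s hs2
    nlinarith

/-- Absolute convergence is used for f = 1/ν̂ at z = 0, where the kernel is a positive constant and
the integrand is a multiple of σ. -/
lemma BoundedGrowthToBloch.isRadialWeight_quot {ω ν : ℝ → ℝ} (hω : IsRadialWeight ω)
    (hν : IsRadialWeight ν) (h : BoundedGrowthToBloch ω (hat ν)) : IsRadialWeight (quot ω ν) := by
  obtain ⟨C, hC⟩ := h
  have h1 := (hC _ (memGrowth_testFun hν 0)).1 0 (by simp [disc])
  have hk : kern ω 0 = kcoef ω 0 := by
    rw [kern_eq, tsum_eq_single 0]
    · simp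
    · intro n hn; simp [hn]
  have hk0 := kcoef_pos hω 0
  have h2 : Integrable (fun ζ : ℂ => (quot ω ν ‖ζ‖ : ℂ)) area := by
    refine (h1.const_mul ((kcoef ω 0 : ℂ))⁻¹).congr (ae_of_all _ fun ζ => ?_)
    have : (kcoef ω 0 : ℂ) ≠ 0 := by exact_mod_cast hk0.ne'
    simp only [projIntegrand_eq, zero_mul, hk, testFun, pow_zero, quot]
    push_cast
    field_simp
  exact isRadialWeight_of_integrable_area hω hν (by simpa using h2.re)

/-- On each circle orthogonality keeps only the n-th term of the kernel. The exponent n+1 of the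
moment combines rⁿ from that term with r from polar coordinates, and the 2 is 2π/π. -/
lemma bergmanProj_testFun {ω ν : ℝ → ℝ} (hω : IsRadialWeight ω)
    (hσ : IsRadialWeight (quot ω ν)) (n : ℕ) {z : ℂ} (hz : z ∈ disc)
    (hint : Integrable (projIntegrand ω (testFun ν n) z) area) :
    bergmanProj ω (testFun ν n) z = ((2 * kcoef ω n * mom (quot ω ν) (n + 1) : ℝ) : ℂ) * z ^ n := by
  unfold bergmanProj
  rw [integral_area hint]
  have h1 : ∀ r ∈ Set.Ioo (0 : ℝ) 1, ∫ θ in Set.Ioo (-Real.pi) Real.pi,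
      (r : ℂ) * projIntegrand ω (testFun ν n) z (circleMap 0 r θ) =
      ((r ^ ((n : ℝ) + 1) * quot ω ν r : ℝ) : ℂ) * (2 * Real.pi * (kcoef ω n * z ^ n)) := by
    intro r hr
    have hr0 := hr.1
    have hv : z * r ∈ disc := by
      rw [disc_norm, norm_mul, Complex.norm_real, Real.norm_of_nonneg hr0.le]
      have := disc_norm.1 hz
      nlinarith [norm_nonneg z, hr.2]
    have hs : Summable fun k : ℕ => ‖(kcoef ω k : ℂ) * (z * r) ^ k‖ := by
      refine (summable_kcoef hω (norm_nonneg (z * r)) (disc_norm.1 hv)).congr fun k => ?_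
      rw [norm_mul (kcoef ω k : ℂ), norm_pow, Complex.norm_real,
        Real.norm_of_nonneg (kcoef_pos hω k).le]
    have h2 : ∀ θ : ℝ, (r : ℂ) * projIntegrand ω (testFun ν n) z (circleMap 0 r θ) =
        ((r * quot ω ν r : ℝ) : ℂ) * (circleMap 0 1 θ ^ n *
          ∑' k : ℕ, ((kcoef ω k : ℂ) * (z * r) ^ k) * conj (circleMap 0 1 θ) ^ k) := by
      intro θ
      have hrc : (r : ℂ) ≠ 0 := by exact_mod_cast hr0.ne'
      rw [projIntegrand_eq, kern_eq, testFun, norm_circleMap_zero, abs_of_pos hr0,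
        circleMap_eq_mul r, mul_div_cancel_left₀ _ hrc]
      have h3 : ∀ k : ℕ, (kcoef ω k : ℂ) * (z * conj (r * circleMap 0 1 θ)) ^ k =
          ((kcoef ω k : ℂ) * (z * r) ^ k) * conj (circleMap 0 1 θ) ^ k := fun k => by
        rw [map_mul, Complex.conj_ofReal]; ring
      simp_rw [h3, quot]
      push_cast
      ring
    simp_rw [h2]
    rw [integral_const_mul, integral_fourier_coeff hs]
    have h4 : r ^ ((n : ℝ) + 1) = r ^ (n + 1) := by rw [← Real.rpow_natCast]; norm_num
    rw [h4]; push_cast; ring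
  rw [setIntegral_congr_fun measurableSet_Ioo h1, integral_mul_const, integral_complex_ofReal]
  have h4 : ∫ r in Set.Ioo (0 : ℝ) 1, r ^ ((n : ℝ) + 1) * quot ω ν r = mom (quot ω ν) (n + 1) := by
    rw [← integral_Ico_eq_integral_Ioo, integral_eq_lintegral_of_nonneg_ae]
    · rfl
    · exact (ae_restrict_iff' measurableSet_Ico).2 (ae_of_all _ fun r hr =>
        mul_nonneg (Real.rpow_nonneg hr.1 _) (hσ.nonneg r hr))
    · exact (Measurable.aestronglyMeasurable (by fun_prop)).mul hσ.integrable.1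
  rw [h4]
  have : (Real.pi : ℂ) ≠ 0 := by exact_mod_cast Real.pi_ne_zero
  push_cast
  field_simp

/-- The Bloch quantity of the monomial P_ω f at the point z = r. For n = 0 the truncated exponent n
- 1 is harmless because of the factor n. -/
lemma BoundedGrowthToBloch.exists_bound {ω ν : ℝ → ℝ} (hω : IsRadialWeight ω)
    (hν : IsRadialWeight ν) (h : BoundedGrowthToBloch ω (hat ν)) :
    ∃ C : ℝ, 0 < C ∧ ∀ n : ℕ, ∀ r ∈ Set.Ioo (0 : ℝ) 1,
      (1 - r) * hat ν r * (n * r ^ (n - 1) * (mom (quot ω ν) (n + 1) / mom ω (2 * n + 1))) ≤ C := by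
  have hσ := h.isRadialWeight_quot hω hν
  obtain ⟨C, hC⟩ := h
  refine ⟨C + 1, by positivity, fun n r hr => ?_⟩
  have hr0 := hr.1
  have hf := hC _ (memGrowth_testFun hν n)
  have hmem : (r : ℂ) ∈ disc := by
    rw [disc_norm, Complex.norm_real, Real.norm_of_nonneg hr0.le]; exact hr.2
  set c : ℝ := 2 * kcoef ω n * mom (quot ω ν) (n + 1) with hc
  have hc1 : c = mom (quot ω ν) (n + 1) / mom ω (2 * n + 1) := by
    rw [hc]; unfold kcoef; field_simp
  have hc0 : 0 ≤ c := by rw [hc1]; positivity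
  have hev : bergmanProj ω (testFun ν n) =ᶠ[𝓝 (r : ℂ)] fun z => (c : ℂ) * z ^ n := by
    filter_upwards [Metric.isOpen_ball.mem_nhds hmem] with z hz
    exact bergmanProj_testFun hω hσ n hz (hf.1 z hz)
  have hd : ‖deriv (bergmanProj ω (testFun ν n)) r‖ = n * r ^ (n - 1) * c := by
    rw [hev.deriv_eq]
    have : HasDerivAt (fun z : ℂ => (c : ℂ) * z ^ n) (c * (n * (r : ℂ) ^ (n - 1))) (r : ℂ) :=
      (hasDerivAt_pow n (r : ℂ)).const_mul _
    rw [this.deriv, norm_mul, norm_mul, norm_pow, Complex.norm_real, Complex.norm_real,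
      Complex.norm_natCast, Real.norm_of_nonneg hc0, Real.norm_of_nonneg hr0.le]
    ring
  have h1 : ENNReal.ofReal ((1 - ‖(r : ℂ)‖) * hat ν ‖(r : ℂ)‖ *
      ‖deriv (bergmanProj ω (testFun ν n)) r‖) ≤ C := by
    refine le_trans (le_iSup₂ (f := fun (z : ℂ) (_ : z ∈ disc) => ENNReal.ofReal ((1 - ‖z‖) *
      hat ν ‖z‖ * ‖deriv (bergmanProj ω (testFun ν n)) z‖)) (r : ℂ) hmem) (hf.2.2.trans ?_)
    exact mul_le_of_le_one_right' (growthNorm_testFun_le hν n)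
  rw [hd, Complex.norm_real, Real.norm_of_nonneg hr0.le, hc1, ← ENNReal.ofReal_coe_nnreal] at h1
  linarith [(ENNReal.ofReal_le_ofReal_iff (NNReal.coe_nonneg C)).1 h1]

/-- For an integer m ≥ 2 choose r = 1 - 1/m. Then (1-r)m = 1, r^(m-1) ≥ e⁻², and doubling of ν gives
ν_m ≤ K ν̂(r). Monotonicity and unit shifts pass to real x. -/
lemma momentCondition_of_boundedGrowthToBloch {ω ν : ℝ → ℝ} (hω : IsRadialWeight ω)
    (hν : UpperDoubling ν) (h : BoundedGrowthToBloch ω (hat ν)) : MomentCondition ω ν := by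
  have hσ := h.isRadialWeight_quot hω hν.1
  obtain ⟨C, hC, hbd⟩ := h.exists_bound hω hν.1
  obtain ⟨K, hK, hle⟩ := hν.exists_mom_le_hat
  obtain ⟨S, hS1, hS⟩ := exists_mom_le_mom_add_one hω
  have hS0 : 0 < S := by linarith
  have hEi : Real.exp 2 * Real.exp (-2) = 1 := by rw [← Real.exp_add]; simp
  have hnat : ∀ m : ℕ, 2 ≤ m → mom ν m * mom (quot ω ν) (m + 1) ≤
      K * Real.exp 2 * C * mom ω (2 * m + 1) := by
    intro m hm
    have hm2 : (2 : ℝ) ≤ m := by exact_mod_cast hm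
    have hm0 : (0 : ℝ) < m := by linarith
    set r : ℝ := 1 - 1 / m with hr
    have hi : 1 / (m : ℝ) ≤ 1 / 2 := one_div_le_one_div_of_le two_pos hm2
    have hi0 : 0 < 1 / (m : ℝ) := by positivity
    have hr2 : 1 / 2 ≤ r := by linarith
    have hr1 : r < 1 := by linarith
    have hr0 : 0 < r := by linarith
    have hE := exp_neg_two_le hr2 hr1
    have e1 : 1 / (1 - r) = m := by rw [hr]; simp
    have h1 := hle r ⟨hr0.le, hr1⟩
    rw [e1] at h1 hE
    rw [Real.rpow_natCast] at hE
    have hE' : Real.exp (-2) ≤ r ^ (m - 1) :=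
      hE.trans (pow_le_pow_of_le_one hr0.le hr1.le (Nat.sub_le m 1))
    have h2 := hbd m r ⟨hr0, hr1⟩
    have hP : 0 < mom ω (2 * m + 1) := momentReal_pos hω (by positivity)
    have hQ : 0 < mom (quot ω ν) (m + 1) := momentReal_pos hσ (by positivity)
    have hH := hat_nonneg ν r
    have e2 : (1 - r) * m = 1 := by rw [hr]; field_simp; ring
    have h3 : hat ν r * Real.exp (-2) * (mom (quot ω ν) (m + 1) / mom ω (2 * m + 1)) ≤ C := by
      refine le_trans ?_ h2
      calc _ ≤ hat ν r * r ^ (m - 1) * (mom (quot ω ν) (m + 1) / mom ω (2 * m + 1)) := by gcongr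
        _ = ((1 - r) * m) * (hat ν r * r ^ (m - 1) *
            (mom (quot ω ν) (m + 1) / mom ω (2 * m + 1))) := by rw [e2, one_mul]
        _ = _ := by ring
    rw [mul_div_assoc', div_le_iff₀ hP] at h3
    calc mom ν m * mom (quot ω ν) (m + 1)
        ≤ K * hat ν r * mom (quot ω ν) (m + 1) := by gcongr
      _ = K * Real.exp 2 * (hat ν r * Real.exp (-2) * mom (quot ω ν) (m + 1)) := by
          linear_combination (-K * hat ν r * mom (quot ω ν) (m + 1)) * hEi
      _ ≤ K * Real.exp 2 * (C * mom ω (2 * m + 1)) := by gcongr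
      _ = _ := by ring
  have h6 : 0 < mom ω 6 := momentReal_pos hω (by norm_num)
  set A := mom ν 0 * mom (quot ω ν) 0 / mom ω 6
  have hA : 0 ≤ A := by positivity
  set B := K * Real.exp 2 * C * S ^ 3
  have hB : 0 < B := by positivity
  refine (momentCondition_iff hω hν.1).2 ⟨hσ, A + B, by positivity, fun x hx => ?_⟩
  have hP : 0 < mom ω (2 * x) := momentReal_pos hω (by positivity)
  rcases le_or_gt x 3 with h3 | h3
  · calc mom ν x * mom (quot ω ν) x ≤ mom ν 0 * mom (quot ω ν) 0 := by
          gcongr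
          · exact mom_anti hν.1 le_rfl hx
          · exact mom_anti hσ le_rfl hx
      _ = A * mom ω 6 := by simp only [A]; field_simp
      _ ≤ (A + B) * mom ω (2 * x) :=
          mul_le_mul (by linarith) (mom_anti hω (by positivity) (by linarith)) h6.le (by positivity)
  -- Taking m one below the floor gives m+1 ≤ x < m+2, so ν_x σ_x ≤ ν_m σ_{m+1}. Since 2x < 2m+4,
  -- three shifts lead from ω_{2m+1} to ω_{2x}, and x > 3 ensures m ≥ 2.
  · obtain ⟨m, hm⟩ : ∃ m : ℕ, ⌊x⌋₊ = m + 1 :=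
      ⟨⌊x⌋₊ - 1, by have : 3 ≤ ⌊x⌋₊ := Nat.le_floor (by exact_mod_cast h3.le)
                    omega⟩
    have hm2 : 2 ≤ m := by
      have : 3 ≤ ⌊x⌋₊ := Nat.le_floor (by exact_mod_cast h3.le)
      omega
    have hx1 : (m : ℝ) + 1 ≤ x := by
      have := Nat.floor_le hx
      rw [hm] at this; exact_mod_cast this
    have hx2 : x < (m : ℝ) + 2 := by
      have := Nat.lt_floor_add_one x
      rw [hm] at this; push_cast at this; linarith
    have hsh : mom ω (2 * m + 1) ≤ S ^ 3 * mom ω (2 * x) := by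
      have a1 := hS (2 * m + 1) (by positivity)
      have a2 := hS (2 * m + 1 + 1) (by positivity)
      have a3 := hS (2 * m + 1 + 1 + 1) (by positivity)
      have a4 : mom ω (2 * m + 1 + 1 + 1 + 1) ≤ mom ω (2 * x) :=
        mom_anti hω (by positivity) (by linarith)
      calc mom ω (2 * m + 1) ≤ S * (S * (S * mom ω (2 * x))) := by
            refine a1.trans ?_
            gcongr
            refine a2.trans ?_
            gcongr
            refine a3.trans ?_
            gcongr
        _ = _ := by ring
    calc mom ν x * mom (quot ω ν) x ≤ mom ν m * mom (quot ω ν) (m + 1) := by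
          gcongr
          · exact mom_anti hν.1 (by positivity) (by linarith)
          · exact mom_anti hσ (by positivity) hx1
      _ ≤ K * Real.exp 2 * C * mom ω (2 * m + 1) := hnat m hm2
      _ ≤ K * Real.exp 2 * C * (S ^ 3 * mom ω (2 * x)) := by gcongr
      _ = B * mom ω (2 * x) := by simp only [B]; ring
      _ ≤ _ := mul_le_mul_of_nonneg_right (by linarith) hP.le

end GrowthBergman

end

theorem mainTheorem3 (ω ν : ℝ → ℝ) (hω : GrowthBergman.IsRadialWeight ω)
    (hν : GrowthBergman.UpperDoubling ν) :
    List.TFAE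
      [GrowthBergman.BoundedGrowthToBloch ω (GrowthBergman.hat ν),
       GrowthBergman.MomentCondition ω ν,
       GrowthBergman.UpperDoubling ω ∧ GrowthBergman.TailCondition ω ν] := by
  tfae_have 1 → 2 := GrowthBergman.momentCondition_of_boundedGrowthToBloch hω hν
  tfae_have 2 → 3 := fun h => ⟨h.upperDoubling hω hν, h.tailCondition hω hν⟩
  tfae_have 3 → 1 := fun h => GrowthBergman.boundedGrowthToBloch_of_tailCondition h.1 hν.1 h.2
  tfae_finish
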